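/- Notation. Let $m,n$ be natural numbers and let $M_{m,n}$ be the space of complex $m\times n$ matrices, identified with $\mathbb C^m\otimes\mathbb C^n$ by $(\eta\otimes\xi)_{ij}=\eta_i\xi_j$. $\|\cdot\|_p$ is the $p$-norm on $\mathbb C^k$; $\|\cdot\|$ is the operator norm of matrices (between Euclidean spaces), also for block matrices with blocks in $M_k(\mathbb C)$. A cross norm on $(\mathbb C^m,\|\cdot\|_p)\otimes(\mathbb C^n,\|\cdot\|_r)$ is a norm $N$ on $M_{m,n}$ with $N(\eta\otimes\xi)=\|\eta\|_p\|\xi\|_r$ for all $\eta,\xi$; $\|\cdot\|_{\vee(p,r)}$ and $\|\cdot\|_{\wedge(p,r)}$ are the injective (minimal) and the projective (maximal) cross norm. For $X\in M_{m,n}$: - $\|X\|_F$ is the norm of $F_X:z\mapsto Xz$, $(\mathbb C^n,\|\cdot\|_\infty)\to(\mathbb C^m,\|\cdot\|_2)$, and $\|X\|_{cbF}$ is its completely bounded norm, where $\mathbb C^n$ is the C*-algebra of diagonal matrices and $\mathbb C^m$ is the column Hilbert space of $m\times 1$ matrices. - $\|X\|_B$ is the norm of the bilinear form $B_X(a,b)=\sum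 a_iX_{ij}b_j$ on $(\mathbb C^m,\|\cdot\|_\infty)\times(\mathbb C^n,\|\cdot\|_\infty)$, and $\|X\|_{cbB}$ is its completely bounded norm in the sense of Christensen and Sinclair (amplifications $(u,w)\mapsto\big(\sum_rB_X(u_{pr},w_{rq})\big)_{pq}$). - $\|X\|_S$ and $\|X\|_{cbS}$ are the norm and the completely bounded norm of the Schur multiplier $A\mapsto X\circ A=(X_{ij}A_{ij})$ on $(M_{m,n},\|\cdot\|)$. - $\|X\|_T$ is the norm of $T_X:(M_{m,n},\|\cdot\|)\to(\mathbb C^n,\|\cdot\|_2)$, $T_X(A)_j=\sum_iX_{ij}A_{ij}$, and $\|X\|_{cbT}$ is its completely bounded norm, with values in the row Hilbert space of $1\times n$ matrices. - $\|X\|_h=\inf\big(\|\sum_k\bar a_ka_k\|_\infty\|\sum_k\bar b_kb_k\|_\infty\big)^{1/2}$ over all finite representations $X=\sum_k\overline{a_k}\otimes b_k$ (the Haagerup tensor norm); $\|X\|_H=\inf\max_i\|x_i\|\max_j\|y_j\|$ over all vectors $x_i,y_j$ in a finite-dimensional complex Hilbert space with $X_{ij}=\langle x_i,y_j\rangle$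 (inner product conjugate-linear in the first variable); $\|X\|_{H'}=\sup\{|\sum X_{ij}Y_{ij}|:\|Y\|_H\le1\}$. - For a linear map $v$ between finite-dimensional normed spaces, $\gamma_2(v)=\inf\|v_1\|\|v_2\|$ over all factorizations $v=v_1v_2$ through finite-dimensional Hilbert spaces, and $\gamma_2^*$ is its trace dual; so for $X$ viewed as a map $(\mathbb C^n,\|\cdot\|_\infty)\to(\mathbb C^m,\|\cdot\|_1)$, $\gamma_2^*(X)=\sup\{|\mathrm{Tr}(XV)|:V:(\mathbb C^m,\|\cdot\|_1)\to(\mathbb C^n,\|\cdot\|_\infty),\ \gamma_2(V)\le1\}$. A norm $N$ on $M_{m,n}$ is conjugate dual to a norm $M$ if $N(X)=\sup\{|\mathrm{Tr}(Y^*X)|:M(Y)\le1\}$ for all $X$. $K_G^{\mathbb C}$ is the least constant $K\ge0$ with $|\sum X_{ij}\langle x_i,y_j\rangle|\le K\|X\|_B$ for all complex matrices $X$ of any size and all vectors $x_i,y_j$ in the unit ball of a finite-dimensional complex Hilbert space. $k_G^{\mathbb C}$ is the least constant $k\ge0$ with $\sum_l\|Xa_l\|_2^2\le k\|X\|_F^2$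 for all complex matrices $X$ of any size and all finite families $(a_l)$ of vectors with $\sum_l|a_l(j)|^2\le1$ for every coordinate $j$. Theorem. Let $X$ be a non-zero $m\times n$ complex matrix of rank $1$ with $X_{ij}=\mu_i\nu_j$, $\mu\in\mathbb C^m$, $\nu\in\mathbb C^n$. Then $\|X\|_F=\|X\|_{cbF}=\|\mu\|_2\|\nu\|_1$, $\|X\|_B=\|X\|_{cbB}=\|\mu\|_1\|\nu\|_1$, $\|X\|_S=\|\mu\|_\infty\|\nu\|_\infty$ and $\|X\|_T=\|\mu\|_2\|\nu\|_\infty$. Moreover, on all of $M_{m,n}$: (i) $\|\cdot\|_F$ is a cross norm on $(\mathbb C^m,\|\cdot\|_2)\otimes(\mathbb C^n,\|\cdot\|_1)$ and equals the injective cross norm $\|\cdot\|_{\vee(2,1)}$; $\|\cdot\|_{cbF}$ is a cross norm on the same tensor product, $\|\cdot\|_{cbF}\le\sqrt{k_G^{\mathbb C}}\,\|\cdot\|_F$, and $\|\cdot\|_{cbF}$ is conjugate dual to $\|\cdot\|_T$. (ii) $\|\cdot\|_B$ is a cross norm on $(\mathbb C^m,\|\cdot\|_1)\otimes(\mathbb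 C^n,\|\cdot\|_1)$ and equals the injective cross norm $\|\cdot\|_{\vee(1,1)}$; $\|\cdot\|_{cbB}$ is a cross norm on the same tensor product, $\|\cdot\|_{cbB}\le K_G^{\mathbb C}\|\cdot\|_B$, and $\|\cdot\|_{cbB}$ is conjugate dual to $\|\cdot\|_S$. (iii) $\|\cdot\|_S=\|\cdot\|_{cbS}$ is a cross norm on $(\mathbb C^m,\|\cdot\|_\infty)\otimes(\mathbb C^n,\|\cdot\|_\infty)$, $\|\cdot\|_{\wedge(\infty,\infty)}\le K_G^{\mathbb C}\|\cdot\|_S$, and $\|\cdot\|_S$ is conjugate dual to $\|\cdot\|_{cbB}$. (iv) $\|\cdot\|_T=\|\cdot\|_{cbT}$ is a cross norm on $(\mathbb C^m,\|\cdot\|_2)\otimes(\mathbb C^n,\|\cdot\|_\infty)$, $\|\cdot\|_{\wedge(2,\infty)}\le\sqrt{k_G^{\mathbb C}}\,\|\cdot\|_T$, and $\|\cdot\|_T$ is conjugate dual to $\|\cdot\|_{cbF}$. (v) $\|\cdot\|_S=\|\cdot\|_H=\|\cdot\|_h$. (vi) $\|\cdot\|_{cbB}=\gamma_2^*(\cdot)=\|\cdot\|_{H'}$,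 where $\gamma_2^*(X)$ is taken for $X$ as a map $(\mathbb C^n,\|\cdot\|_\infty)\to(\mathbb C^m,\|\cdot\|_1)$. -/

import Mathlib

open scoped Matrix ENNReal

noncomputable section

namespace GrothendieckNorms

/-! ### Vector norms, operator norms, cross norms -/

/-- The `p`-norm of a vector of `ℂ^k`, `1 ≤ p ≤ ∞`. -/
def pNorm (p : ℝ≥0∞) {k : ℕ} (v : Fin k → ℂ) : ℝ := ‖WithLp.toLp p v‖

open scoped Matrix.Norms.L2Operator in
/-- The operator norm of a complex matrix, acting between Euclidean spaces. -/
def opNorm {ι κ : Type} [Fintype ι] [DecidableEq ι] [Fintype κ] [DecidableEq κ]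
    (A : Matrix ι κ ℂ) : ℝ := ‖A‖

/-- The norm of the linear map `z ↦ A z` from `(ℂ^n, ‖·‖_p)` to `(ℂ^m, ‖·‖_r)`. -/
def mapNorm (p r : ℝ≥0∞) {m n : ℕ} (A : Matrix (Fin m) (Fin n) ℂ) : ℝ :=
  sSup {t | ∃ z : Fin n → ℂ, pNorm p z ≤ 1 ∧ t = pNorm r (A *ᵥ z)}

/-- `f` lies in the unit ball of the dual of `(ℂ^k, ‖·‖_p)`, for the pairing `∑ i, f i * z i`. -/
def InDualBall (p : ℝ≥0∞) {k : ℕ} (f : Fin k → ℂ) : Prop :=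
  ∀ z : Fin k → ℂ, ‖f ⬝ᵥ z‖ ≤ pNorm p z

/-- The injective (minimal) cross norm on `(ℂ^m, ‖·‖_p) ⊗ (ℂ^n, ‖·‖_r)`, transported to
`m × n` matrices: the supremum of `|(f ⊗ g)(X)|` over the unit balls of the two dual spaces. -/
def injNorm (p r : ℝ≥0∞) {m n : ℕ} (X : Matrix (Fin m) (Fin n) ℂ) : ℝ :=
  sSup {t | ∃ (f : Fin m → ℂ) (g : Fin n → ℂ), InDualBall p f ∧ InDualBall r g ∧
    t = ‖∑ i, ∑ j, X i j * f i * g j‖}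

/-- The projective (maximal) cross norm on `(ℂ^m, ‖·‖_p) ⊗ (ℂ^n, ‖·‖_r)`, transported to
`m × n` matrices. -/
def projNorm (p r : ℝ≥0∞) {m n : ℕ} (X : Matrix (Fin m) (Fin n) ℂ) : ℝ :=
  sInf {t | ∃ (d : ℕ) (a : Fin d → Fin m → ℂ) (b : Fin d → Fin n → ℂ),
    X = ∑ k, Matrix.vecMulVec (a k) (b k) ∧ t = ∑ k, pNorm p (a k) * pNorm r (b k)}

/-- `N` is a norm on the complex vector space of `m × n` matrices. -/
def IsMatrixNorm {m n : ℕ} (N : Matrix (Fin m) (Fin n) ℂ → ℝ) : Prop :=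
  (∀ X, N X = 0 → X = 0) ∧ (∀ X Y, N (X + Y) ≤ N X + N Y) ∧
    ∀ (c : ℂ) (X), N (c • X) = ‖c‖ * N X

/-- `N` is a cross norm on `(ℂ^m, ‖·‖_p) ⊗ (ℂ^n, ‖·‖_r)`, where `η ⊗ ξ` is the matrix with
entries `η i * ξ j`. -/
def IsCrossNorm (p r : ℝ≥0∞) {m n : ℕ} (N : Matrix (Fin m) (Fin n) ℂ → ℝ) : Prop :=
  IsMatrixNorm N ∧ ∀ (η : Fin m → ℂ) (ξ : Fin n → ℂ),
    N (Matrix.vecMulVec η ξ) = pNorm p η * pNorm r ξ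

/-- `N` is the conjugate dual norm of `M`: `N X = sup {|Tr (Y* X)| : M Y ≤ 1}`. -/
def IsConjDual {m n : ℕ} (N M : Matrix (Fin m) (Fin n) ℂ → ℝ) : Prop :=
  ∀ X, IsLUB {t | ∃ Y, M Y ≤ 1 ∧ t = ‖(Yᴴ * X).trace‖} (N X)

/-! ### Completely bounded norms -/

/-- The `k`-th amplification of a map `Φ` from `V` into `a × b` matrices, as a block matrix. -/
def amplify {V a b : Type} {k : ℕ} (Φ : V → Matrix a b ℂ) (U : Matrix (Fin k) (Fin k) V) :
    Matrix (Fin k × a) (Fin k × b) ℂ :=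
  Matrix.of fun p q => Φ (U p.1 q.1) p.2 q.2

/-- The completely bounded norm of a linear map `Φ` from the operator space `V`, realized as a
space of matrices by the linear embedding `ι`, into the operator space of `c × d` matrices. -/
def cbNorm {V a b c d : Type} [Fintype a] [DecidableEq a] [Fintype b] [DecidableEq b]
    [Fintype c] [DecidableEq c] [Fintype d] [DecidableEq d]
    (ι : V → Matrix a b ℂ) (Φ : V → Matrix c d ℂ) : ℝ :=
  sSup {t | ∃ (k : ℕ) (U : Matrix (Fin k) (Fin k) V),
    opNorm (amplify ι U) ≤ 1 ∧ t = opNorm (amplify Φ U)}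

/-- The `k`-th amplification of a bilinear form `φ`: its `(p, q)` entry is
`∑ r, φ (U p r) (W r q)`. -/
def amplifyBilin {V W : Type} {k : ℕ} (φ : V → W → ℂ)
    (U : Matrix (Fin k) (Fin k) V) (Z : Matrix (Fin k) (Fin k) W) :
    Matrix (Fin k) (Fin k) ℂ :=
  Matrix.of fun p q => ∑ r, φ (U p r) (Z r q)

/-- The completely bounded norm (in the sense of Christensen and Sinclair) of a bilinear form on
a product of two operator spaces, realized as spaces of matrices by `ι₁` and `ι₂`. -/
def cbNormBilin {V W a b c d : Type} [Fintype a] [DecidableEq a] [Fintype b] [DecidableEq b]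
    [Fintype c] [DecidableEq c] [Fintype d] [DecidableEq d]
    (ι₁ : V → Matrix a b ℂ) (ι₂ : W → Matrix c d ℂ) (φ : V → W → ℂ) : ℝ :=
  sSup {t | ∃ (k : ℕ) (U : Matrix (Fin k) (Fin k) V) (Z : Matrix (Fin k) (Fin k) W),
    opNorm (amplify ι₁ U) ≤ 1 ∧ opNorm (amplify ι₂ Z) ≤ 1 ∧ t = opNorm (amplifyBilin φ U Z)}

/-- The abelian C*-algebra `ℂ^n` (sup norm), realized as diagonal matrices. -/
def diagEmb {n : ℕ} (z : Fin n → ℂ) : Matrix (Fin n) (Fin n) ℂ := Matrix.diagonal z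

/-! ### The norms `F, cbF, B, cbB, S, cbS, T, cbT` -/

section Norms

variable {m n : ℕ}

/-- `‖X‖_F`: the norm of `F_X : (ℂ^n, ‖·‖_∞) → (ℂ^m, ‖·‖_2)`, `z ↦ X z`. -/
def normF (X : Matrix (Fin m) (Fin n) ℂ) : ℝ := mapNorm ∞ 2 X

/-- `‖X‖_cbF`: the completely bounded norm of `F_X`, with values in the column Hilbert space of
`m × 1` matrices. -/
def normCbF (X : Matrix (Fin m) (Fin n) ℂ) : ℝ :=
  cbNorm (diagEmb (n := n)) fun z => Matrix.replicateCol (Fin 1) (X *ᵥ z)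

/-- The bilinear form `B_X (a, b) = ∑ a_i X_ij b_j` on `ℂ^m × ℂ^n`. -/
def bilinForm (X : Matrix (Fin m) (Fin n) ℂ) (a : Fin m → ℂ) (b : Fin n → ℂ) : ℂ :=
  ∑ i, ∑ j, a i * X i j * b j

/-- `‖X‖_B`: the norm of `B_X` on `(ℂ^m, ‖·‖_∞) × (ℂ^n, ‖·‖_∞)`. -/
def normB (X : Matrix (Fin m) (Fin n) ℂ) : ℝ :=
  sSup {t | ∃ (a : Fin m → ℂ) (b : Fin n → ℂ), pNorm ∞ a ≤ 1 ∧ pNorm ∞ b ≤ 1 ∧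
    t = ‖bilinForm X a b‖}

/-- `‖X‖_cbB`: the completely bounded norm of `B_X`. -/
def normCbB (X : Matrix (Fin m) (Fin n) ℂ) : ℝ :=
  cbNormBilin (diagEmb (n := m)) (diagEmb (n := n)) (bilinForm X)

/-- `‖X‖_S`: the norm of the Schur multiplier `A ↦ X ∘ A` on the `m × n` matrices with the
operator norm. -/
def normS (X : Matrix (Fin m) (Fin n) ℂ) : ℝ :=
  sSup {t | ∃ A : Matrix (Fin m) (Fin n) ℂ, opNorm A ≤ 1 ∧ t = opNorm (X.hadamard A)}

/-- `‖X‖_cbS`: the completely bounded norm of the Schur multiplier. -/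
def normCbS (X : Matrix (Fin m) (Fin n) ℂ) : ℝ :=
  cbNorm (fun A : Matrix (Fin m) (Fin n) ℂ => A) fun A => X.hadamard A

/-- The map `T_X` sending an `m × n` matrix `A` to the vector of the column sums of `X ∘ A`. -/
def columnSums (X A : Matrix (Fin m) (Fin n) ℂ) : Fin n → ℂ := fun j => ∑ i, X i j * A i j

/-- `‖X‖_T`: the norm of `T_X` from the `m × n` matrices with the operator norm to
`(ℂ^n, ‖·‖_2)`. -/
def normT (X : Matrix (Fin m) (Fin n) ℂ) : ℝ :=
  sSup {t | ∃ A : Matrix (Fin m) (Fin n) ℂ, opNorm A ≤ 1 ∧ t = pNorm 2 (columnSums X A)}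

/-- `‖X‖_cbT`: the completely bounded norm of `T_X`, with values in the row Hilbert space of
`1 × n` matrices. -/
def normCbT (X : Matrix (Fin m) (Fin n) ℂ) : ℝ :=
  cbNorm (fun A : Matrix (Fin m) (Fin n) ℂ => A)
    fun A => Matrix.replicateRow (Fin 1) (columnSums X A)

/-! ### The norms `H, h, H', γ₂, γ₂*` -/

/-- The Haagerup tensor norm on `ℂ^m ⊗ ℂ^n`, both factors with the sup norm: the infimum of
`(‖∑ a_k* a_k‖ ‖∑ b_k* b_k‖)^(1/2)` over all `X = ∑ conj(a_k) ⊗ b_k`. -/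
def haagerupNorm (X : Matrix (Fin m) (Fin n) ℂ) : ℝ :=
  sInf {t | ∃ (d : ℕ) (a : Fin d → Fin m → ℂ) (b : Fin d → Fin n → ℂ),
    X = ∑ k, Matrix.vecMulVec (star (a k)) (b k) ∧
    t = √(pNorm ∞ (∑ k, star (a k) * a k) * pNorm ∞ (∑ k, star (b k) * b k))}

/-- The norm `‖·‖_H` on `ℂ^m ⊗ ℂ^n`, both factors with the sup norm: the infimum of
`max ‖x_i‖ · max ‖y_j‖` over all vectors in Hilbert spaces with `X_ij = ⟨x_i, y_j⟩`. -/
def normH (X : Matrix (Fin m) (Fin n) ℂ) : ℝ :=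
  sInf {t | ∃ (d : ℕ) (x : Fin m → EuclideanSpace ℂ (Fin d))
      (y : Fin n → EuclideanSpace ℂ (Fin d)),
    (∀ i j, X i j = inner ℂ (x i) (y j)) ∧ t = (⨆ i, ‖x i‖) * ⨆ j, ‖y j‖}

/-- The norm `‖·‖_{H'}` on `ℂ^m ⊗ ℂ^n`, both factors with the `1`-norm: the dual norm of
`‖·‖_H`, for the bilinear pairing `∑ X_ij Y_ij`. -/
def normH' (X : Matrix (Fin m) (Fin n) ℂ) : ℝ :=
  sSup {t | ∃ Y : Matrix (Fin m) (Fin n) ℂ, normH Y ≤ 1 ∧ t = ‖∑ i, ∑ j, X i j * Y i j‖}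

/-- The norm `γ₂` of factorization through a Hilbert space, of the linear map
`(ℂ^n, ‖·‖_p) → (ℂ^m, ‖·‖_r)` with matrix `V`. -/
def gammaTwo (p r : ℝ≥0∞) (V : Matrix (Fin m) (Fin n) ℂ) : ℝ :=
  sInf {t | ∃ (d : ℕ) (C : Matrix (Fin m) (Fin d) ℂ) (A : Matrix (Fin d) (Fin n) ℂ),
    V = C * A ∧ t = mapNorm 2 r C * mapNorm p 2 A}

/-- The adjoint (trace dual) norm `γ₂*` of the linear map
`(ℂ^n, ‖·‖_p) → (ℂ^m, ‖·‖_r)` with matrix `X`: the supremum of `|Tr (X V)|` over all maps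
`V : (ℂ^m, ‖·‖_r) → (ℂ^n, ‖·‖_p)` with `γ₂ V ≤ 1`. -/
def gammaTwoStar (p r : ℝ≥0∞) (X : Matrix (Fin m) (Fin n) ℂ) : ℝ :=
  sSup {t | ∃ V : Matrix (Fin n) (Fin m) ℂ, gammaTwo r p V ≤ 1 ∧ t = ‖(X * V).trace‖}

end Norms

/-! ### The Grothendieck constants -/

/-- The complex Grothendieck constant `K_G`: the best constant in Grothendieck's inequality
`|∑ X_ij ⟨x_i, y_j⟩| ≤ K ‖X‖_B` for vectors in unit balls of Hilbert spaces. -/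
def bigConst : ℝ :=
  sInf {K | 0 ≤ K ∧ ∀ (m n d : ℕ) (X : Matrix (Fin m) (Fin n) ℂ)
    (x : Fin m → EuclideanSpace ℂ (Fin d)) (y : Fin n → EuclideanSpace ℂ (Fin d)),
    (∀ i, ‖x i‖ ≤ 1) → (∀ j, ‖y j‖ ≤ 1) →
      ‖∑ i, ∑ j, X i j * inner ℂ (x i) (y j)‖ ≤ K * normB X}

/-- The complex little Grothendieck constant `k_G`: the best constant in the little inequality
`∑ ‖X a_l‖₂² ≤ k ‖X‖_F² · max_j ∑ |a_l(j)|²` for finite families of vectors of `ℂ^n`. -/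
def littleConst : ℝ :=
  sInf {k | 0 ≤ k ∧ ∀ (m n d : ℕ) (X : Matrix (Fin m) (Fin n) ℂ) (a : Fin d → Fin n → ℂ),
    (∀ j, ∑ l, ‖a l j‖ ^ 2 ≤ 1) → ∑ l, pNorm 2 (X *ᵥ a l) ^ 2 ≤ k * normF X ^ 2}

end GrothendieckNorms

end

noncomputable section

namespace GrothendieckNorms

/-! ### Cauchy–Schwarz and operator norms -/

/-! Every norm that is defined by a supremum is the supremum of `‖pair X Y‖` over an explicit set of
matrices `Y`. For `normB` and `normF` these are rank one tensors of dual unit vectors. For `normCbB`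
and `normCbF` they are the Gram matrices `gramId` and `gramUnit`, because an amplification over
diagonal matrices, tested on two vectors, is a pairing with a Gram matrix and conversely. For
`normS` and `normT` they are contractions `A` weighted by unit vectors, `schurSet` and `columnSet`.
In this form the norm axioms, the cross norm identities and the comparison with the injective norm
follow by testing on suitable rank one tensors and by Cauchy–Schwarz.

The heart is that the unit ball of `normS` is `gramId`, and that of `normT` is `gramUnit`, up to
factors arbitrarily close to `1`. That Gram matrices are in the ball is `norm_gram_bilin_le`. For
the converse, the cone generated by rank one Gram data is separated from `(X, N, N)`
(`mem_closure_hull`). A functional that is nonnegative on this cone has the form `(Y, p, q)` with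
`|∑ u_i v_j Y_ij| ≤ ∑ p |u_i|² + ∑ q |v_j|²`, hence `Y = 2 √p A √q` with a contraction `A`
(`exists_contraction_of_pairing_le`), and such a `Y` is controlled by the norm of `X`. Perturbing
inside the cone removes the closure (`exists_smul_gram`).

`DualSystem` records this situation, and conjugate duality in both directions follows formally. A
Gram representation also bounds every amplification, which gives `normS = normCbS` and `normT =
normCbT`; and it is the same datum as a representation in the definition of `normH`, `haagerupNorm`
or `gammaTwo`.

`bigConst` and `littleConst` are infima, so the sets of admissible constants have to be shown
nonempty. `normCbB_le_mul_normB` proves Grothendieck's inequality with constant `128` by truncating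
Rademacher sums, and the little inequality is its application to `Xᴴ * X`. The bounds for the
projective norms are dual to those for `normCbB` and `normCbF`, by a second separation argument
(`projNorm_le`). -/

lemma norm_sum_mul_le {κ : Type*} [Fintype κ] (u v : κ → ℂ) :
    ‖∑ k, u k * v k‖ ≤ √(∑ k, ‖u k‖ ^ 2) * √(∑ k, ‖v k‖ ^ 2) := by
  refine (norm_sum_le _ _).trans ?_
  simp only [norm_mul]
  exact Real.sum_mul_le_sqrt_mul_sqrt _ _ _

lemma norm_sum_mul_le_of_sq {κ : Type*} [Fintype κ] {u v : κ → ℂ} {a b : ℝ} (ha : 0 ≤ a)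
    (hb : 0 ≤ b) (hu : ∑ k, ‖u k‖ ^ 2 ≤ a ^ 2) (hv : ∑ k, ‖v k‖ ^ 2 ≤ b ^ 2) :
    ‖∑ k, u k * v k‖ ≤ a * b :=
  (norm_sum_mul_le u v).trans
    (mul_le_mul ((Real.sqrt_le_left ha).2 hu) ((Real.sqrt_le_left hb).2 hv) (Real.sqrt_nonneg _) ha)

/-- Self-duality of `ℓ²` without conjugation: the pairing with the normalized conjugate of `w`
equals the norm of `w`. This converts estimates of Euclidean norms into estimates of pairings
throughout. -/
lemma sum_sq_le_one_of_pairing {κ : Type*} [Fintype κ] {w : κ → ℂ} {c : ℝ} (hc : 0 ≤ c)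
    (h : ∀ u : κ → ℂ, ∑ k, ‖u k‖ ^ 2 ≤ 1 → ‖∑ k, u k * w k‖ ≤ c) :
    √(∑ k, ‖w k‖ ^ 2) ≤ c := by
  set s := √(∑ k, ‖w k‖ ^ 2) with hs
  have hs2 : s ^ 2 = ∑ k, ‖w k‖ ^ 2 := Real.sq_sqrt (by positivity)
  rcases (Real.sqrt_nonneg (∑ k, ‖w k‖ ^ 2)).eq_or_lt with h0 | h0
  · rw [hs, ← h0]; exact hc
  rw [← hs] at h0
  have h1 := h (fun k => (s : ℂ)⁻¹ * star (w k)) (by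
    simp only [norm_mul, norm_inv, Complex.norm_real, norm_star, mul_pow, ← Finset.mul_sum, ← hs2,
      Real.norm_eq_abs, abs_of_pos h0]
    field_simp; exact le_rfl)
  have h2 : ∑ k, (s : ℂ)⁻¹ * star (w k) * w k = (s : ℂ) := by
    have h3 : ∀ k, (s : ℂ)⁻¹ * star (w k) * w k = (s : ℂ)⁻¹ * ((‖w k‖ ^ 2 : ℝ) : ℂ) := by
      intro k
      rw [mul_assoc, Complex.star_def, Complex.conj_mul']; push_cast; rfl
    simp only [h3, ← Finset.mul_sum, ← Complex.ofReal_sum, ← hs2]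
    have : (s : ℂ) ≠ 0 := by exact_mod_cast h0.ne'
    push_cast; field_simp
  rw [h2, Complex.norm_real, Real.norm_eq_abs, abs_of_pos h0] at h1
  exact h1

section OpNorm

variable {ι κ : Type} [Fintype ι] [DecidableEq ι] [Fintype κ] [DecidableEq κ]

open scoped Matrix.Norms.L2Operator in
lemma opNorm_nonneg (A : Matrix ι κ ℂ) : 0 ≤ opNorm A := norm_nonneg A

lemma sqrt_mulVec_le (A : Matrix ι κ ℂ) (v : κ → ℂ) :
    √(∑ i, ‖(A *ᵥ v) i‖ ^ 2) ≤ opNorm A * √(∑ j, ‖v j‖ ^ 2) := by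
  have h := Matrix.l2_opNorm_mulVec A (WithLp.toLp 2 v)
  simpa [EuclideanSpace.norm_eq, opNorm] using h

lemma opNorm_le_of_mulVec {A : Matrix ι κ ℂ} {C : ℝ} (hC : 0 ≤ C)
    (h : ∀ v, √(∑ i, ‖(A *ᵥ v) i‖ ^ 2) ≤ C * √(∑ j, ‖v j‖ ^ 2)) : opNorm A ≤ C := by
  unfold opNorm
  rw [Matrix.l2_opNorm_def]
  refine ContinuousLinearMap.opNorm_le_bound _ hC fun x => ?_
  have := h x.ofLp
  simpa [EuclideanSpace.norm_eq] using this

omit [DecidableEq ι] [DecidableEq κ] in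
lemma sum_mulVec (A : Matrix ι κ ℂ) (u : ι → ℂ) (v : κ → ℂ) :
    ∑ i, u i * (A *ᵥ v) i = ∑ i, ∑ j, u i * A i j * v j := by
  simp [Matrix.mulVec, dotProduct, Finset.mul_sum, mul_assoc]

lemma norm_bilin_le_opNorm (A : Matrix ι κ ℂ) (u : ι → ℂ) (v : κ → ℂ) :
    ‖∑ i, ∑ j, u i * A i j * v j‖ ≤
      opNorm A * (√(∑ i, ‖u i‖ ^ 2) * √(∑ j, ‖v j‖ ^ 2)) := by
  rw [← sum_mulVec]
  calc _ ≤ _ := norm_sum_mul_le _ _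
    _ ≤ √(∑ i, ‖u i‖ ^ 2) * (opNorm A * √(∑ j, ‖v j‖ ^ 2)) := by
        gcongr; exact sqrt_mulVec_le A v
    _ = _ := by ring

lemma norm_bilin_le {A : Matrix ι κ ℂ} (hA : opNorm A ≤ 1) {u : ι → ℂ} {v : κ → ℂ} {a b : ℝ}
    (ha : 0 ≤ a) (hb : 0 ≤ b) (hu : ∑ i, ‖u i‖ ^ 2 ≤ a ^ 2) (hv : ∑ i, ‖v i‖ ^ 2 ≤ b ^ 2) :
    ‖∑ i, ∑ j, u i * A i j * v j‖ ≤ a * b := by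
  refine (norm_bilin_le_opNorm A u v).trans ?_
  have h1 : √(∑ i, ‖u i‖ ^ 2) ≤ a := (Real.sqrt_le_left ha).2 hu
  have h2 : √(∑ i, ‖v i‖ ^ 2) ≤ b := (Real.sqrt_le_left hb).2 hv
  have h3 := mul_le_mul h1 h2 (Real.sqrt_nonneg _) ha
  have h4 : 0 ≤ √(∑ i, ‖u i‖ ^ 2) * √(∑ i, ‖v i‖ ^ 2) := by positivity
  nlinarith [opNorm_nonneg A]

lemma opNorm_le_of_bilin {A : Matrix ι κ ℂ} {C : ℝ}
    (h : ∀ (u : ι → ℂ) (v : κ → ℂ), ∑ i, ‖u i‖ ^ 2 ≤ 1 → ∑ j, ‖v j‖ ^ 2 ≤ 1 →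
      ‖∑ i, ∑ j, u i * A i j * v j‖ ≤ C) : opNorm A ≤ C := by
  have hC : 0 ≤ C := by simpa using h 0 0 (by simp) (by simp)
  refine opNorm_le_of_mulVec hC fun v => ?_
  refine sum_sq_le_one_of_pairing (by positivity) fun u hu => ?_
  set s := √(∑ j, ‖v j‖ ^ 2) with hs
  have h1 : √(∑ j, ‖(∑ i, u i * A i j)‖ ^ 2) ≤ C := by
    refine sum_sq_le_one_of_pairing hC fun v' hv' => ?_
    have := h u v' hu hv'
    rw [Finset.sum_comm] at this
    simpa only [Finset.mul_sum, mul_comm (v' _)] using (by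
      simpa only [Finset.sum_mul] using this : ‖∑ j, (∑ i, u i * A i j) * v' j‖ ≤ C)
  rw [sum_mulVec, Finset.sum_comm]
  simp only [← Finset.sum_mul]
  refine (norm_sum_mul_le _ _).trans ?_
  gcongr

lemma sum_sq_mulVec_le {A : Matrix ι κ ℂ} (hA : opNorm A ≤ 1) (v : κ → ℂ) :
    ∑ i, ‖∑ j, A i j * v j‖ ^ 2 ≤ ∑ j, ‖v j‖ ^ 2 := by
  have h := (sqrt_mulVec_le A v).trans (mul_le_of_le_one_left (Real.sqrt_nonneg _) hA)
  rw [Real.sqrt_le_sqrt_iff (by positivity)] at h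
  simpa [Matrix.mulVec, dotProduct] using h

lemma sum_sq_vecMul_le {A : Matrix ι κ ℂ} (hA : opNorm A ≤ 1) (u : ι → ℂ) :
    ∑ j, ‖∑ i, u i * A i j‖ ^ 2 ≤ ∑ i, ‖u i‖ ^ 2 := by
  rw [← Real.sqrt_le_sqrt_iff (by positivity)]
  refine sum_sq_le_one_of_pairing (by positivity) fun v hv => ?_
  have := norm_bilin_le hA (u := u) (v := v) (Real.sqrt_nonneg (∑ i, ‖u i‖ ^ 2)) zero_le_one
    (Real.sq_sqrt (by positivity)).ge (by simpa using hv)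
  rw [Finset.sum_comm, mul_one] at this
  simpa only [Finset.mul_sum, mul_comm (v _)] using (by
      simpa only [Finset.sum_mul] using this : ‖∑ j, (∑ i, u i * A i j) * v j‖ ≤ _)

end OpNorm

/-! ### Gram matrices and a Farkas-type duality -/

/-- Farkas' lemma: a point outside the closed convex cone generated by `s` is strictly separated
from it by a functional that is nonnegative on the cone. -/
lemma mem_closure_hull {E : Type*} [NormedAddCommGroup E] [NormedSpace ℝ E] {s : Set E} {x₀ : E}
    (h : ∀ f : E →L[ℝ] ℝ, (∀ x ∈ s, 0 ≤ f x) → 0 ≤ f x₀) :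
    x₀ ∈ closure (PointedCone.hull ℝ s : Set E) := by
  by_contra hx
  let C : ProperCone ℝ E := Submodule.closure (PointedCone.hull ℝ s)
  obtain ⟨f, hf, hf₀⟩ := C.hyperplane_separation_point (x₀ := x₀) hx
  exact absurd (h f fun x hx' => hf x (subset_closure (Submodule.subset_span hx'))) (not_le.2 hf₀)

variable {m n : ℕ}

/-- The bilinear pairing `∑ X_ij Y_ij`. -/
def pair (X Y : Matrix (Fin m) (Fin n) ℂ) : ℂ := ∑ i, ∑ j, X i j * Y i j

/-- The cones below are real while the matrices are complex. The representing matrix has real and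
imaginary parts `g(e_ij)` and `-g(i e_ij)`. -/
lemma exists_re_pair (g : (Fin m → Fin n → ℂ) →ₗ[ℝ] ℝ) :
    ∃ Y : Matrix (Fin m) (Fin n) ℂ, ∀ Z, g Z = (pair Z Y).re := by
  refine ⟨fun i j => ⟨g (Pi.single i (Pi.single j 1)),
    - g (Pi.single i (Pi.single j Complex.I))⟩, fun Z => ?_⟩
  have hZ : Z = ∑ i, ∑ j, ((Z i j).re • (Pi.single i (Pi.single j 1) : Fin m → Fin n → ℂ) +
      (Z i j).im • (Pi.single i (Pi.single j Complex.I) : Fin m → Fin n → ℂ)) := by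
    ext i j
    simp [Finset.sum_apply, Pi.single_apply, Finset.sum_add_distrib, ite_apply,
      Complex.re_add_im]
  conv_lhs => rw [hZ]
  simp [pair, Complex.mul_re]

/-- The matrices with entries `∑ k, x_i(k) y_j(k)`, where the vectors `y_j` lie in the unit ball
and the families of the `x_i` with `π i = r` lie in the unit ball of `ℓ²`. -/
def gramSet {R : Type} [DecidableEq R] (π : Fin m → R) : Set (Matrix (Fin m) (Fin n) ℂ) :=
  {Z | ∃ (d : ℕ) (x : Fin m → Fin d → ℂ) (y : Fin n → Fin d → ℂ),
    (∀ i j, Z i j = ∑ k, x i k * y j k) ∧ (∀ r, ∑ i with π i = r, ∑ k, ‖x i k‖ ^ 2 ≤ 1) ∧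
    ∀ j, ∑ k, ‖y j k‖ ^ 2 ≤ 1}

section Cone

variable {R : Type} [Fintype R] [DecidableEq R]

/-- The generators of the cone of Gram matrices with bounds on the diagonal. -/
def gramGen (π : Fin m → R) (u : Fin m → ℂ) (v : Fin n → ℂ) (s : R → ℝ) :
    (Fin m → Fin n → ℂ) × (R → ℝ) × (Fin n → ℝ) :=
  (fun i j => u i * v j, fun r => ∑ i with π i = r, ‖u i‖ ^ 2 + s r, fun j => ‖v j‖ ^ 2)

/-- The cone of Gram matrices with bounds on the diagonal. -/
def gramCone (m n : ℕ) (π : Fin m → R) :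
    PointedCone ℝ ((Fin m → Fin n → ℂ) × (R → ℝ) × (Fin n → ℝ)) :=
  PointedCone.hull ℝ {e | ∃ u v s, 0 ≤ s ∧ e = gramGen π u v s}

omit [Fintype R] in
-- Each generator of a conic combination supplies one coordinate of the Hilbert space; its
-- coefficient is split as a product of two square roots between `x` and `y`. The slack `s` only
-- weakens the bound on `x`.
lemma exists_of_mem_gramCone {π : Fin m → R} {Z : Fin m → Fin n → ℂ} {a : R → ℝ} {b : Fin n → ℝ}
    (h : (Z, a, b) ∈ gramCone m n π) :
    ∃ (d : ℕ) (x : Fin m → Fin d → ℂ) (y : Fin n → Fin d → ℂ),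
    (∀ i j, Z i j = ∑ k, x i k * y j k) ∧ (∀ r, ∑ i with π i = r, ∑ k, ‖x i k‖ ^ 2 ≤ a r) ∧
    ∀ j, ∑ k, ‖y j k‖ ^ 2 ≤ b j := by
  obtain ⟨d, f, g, hfg⟩ := (Submodule.mem_span_set').1 h
  choose u v s hs hg using fun k => (g k).2
  simp only [hg, gramGen] at hfg
  have hf : ∀ k, ((√(f k : ℝ) : ℝ) : ℂ) * ((√(f k : ℝ) : ℝ) : ℂ) = ((f k : ℝ) : ℂ) := fun k => by
    rw [← Complex.ofReal_mul, Real.mul_self_sqrt (f k).2]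
  have hf' : ∀ k, (√(f k : ℝ)) ^ 2 = (f k : ℝ) := fun k => Real.sq_sqrt (f k).2
  refine ⟨d, fun i k => √(f k : ℝ) * u k i, fun j k => √(f k : ℝ) * v k j, ?_, ?_, ?_⟩
  · intro i j
    have := congrFun (congrFun (congrArg Prod.fst hfg) i) j
    simp only [Prod.fst_sum, Finset.sum_apply, Prod.smul_fst, Pi.smul_apply] at this
    rw [← this]
    refine Finset.sum_congr rfl fun k _ => ?_
    rw [mul_mul_mul_comm, hf]; rfl
  · intro r
    have := congrFun (congrArg (fun e => e.2.1) hfg) r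
    simp only [Prod.fst_sum, Prod.snd_sum, Finset.sum_apply, Prod.smul_fst, Prod.smul_snd,
      Pi.smul_apply] at this
    rw [← this, Finset.sum_comm]
    refine Finset.sum_le_sum fun k _ => ?_
    simp only [norm_mul, mul_pow, Complex.norm_real, Real.norm_eq_abs, sq_abs, hf',
      ← Finset.mul_sum]
    exact mul_le_mul_of_nonneg_left (le_add_of_nonneg_right (hs k r)) (f k).2
  · intro j
    have := congrFun (congrArg (fun e => e.2.2) hfg) j
    simp only [Prod.snd_sum, Finset.sum_apply, Prod.smul_snd,
      Pi.smul_apply] at this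
    rw [← this]
    refine Finset.sum_le_sum fun k _ => ?_
    simp only [norm_mul, mul_pow, Complex.norm_real, Real.norm_eq_abs, sq_abs, hf']
    exact le_rfl

omit [Fintype R] in
-- Makes it possible to pass from the closure of the cone to the cone: an error `W` is written row
-- by row as `√δ e_i ⊗ W_i / √δ`, so that both factors cost at most `δ` per row.
lemma small_mem_gramCone (π : Fin m → R) {δ : ℝ} (hδ : 0 < δ) {W : Fin m → Fin n → ℂ}
    (hW : ∀ i j, ‖W i j‖ ≤ δ) :
    ∃ (a : R → ℝ) (b : Fin n → ℝ), (∀ r, a r ≤ m * δ) ∧ (∀ j, b j ≤ m * δ) ∧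
      (W, a, b) ∈ gramCone m n π := by
  have hs : √δ ≠ 0 := (Real.sqrt_pos.2 hδ).ne'
  have hs' : ((√δ : ℝ) : ℂ) ≠ 0 := by exact_mod_cast hs
  have hmem : ∑ i, gramGen π (Pi.single i ((√δ : ℝ) : ℂ)) (fun j => W i j / ((√δ : ℝ) : ℂ)) 0 ∈
      gramCone m n π :=
    Submodule.sum_mem _ fun i _ => Submodule.subset_span ⟨_, _, _, le_rfl, rfl⟩
  set S := ∑ i, gramGen π (Pi.single i ((√δ : ℝ) : ℂ)) (fun j => W i j / ((√δ : ℝ) : ℂ)) 0 with hS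
  have hSW : (W, S.2.1, S.2.2) = S := by
    refine Prod.ext ?_ (Prod.ext rfl rfl)
    ext i j
    simp only [hS, gramGen, Prod.fst_sum, Finset.sum_apply]
    rw [Finset.sum_eq_single i]
    · simp; field_simp
    · intro i' _ h; simp [h.symm]
    · simp
  refine ⟨S.2.1, S.2.2, ?_, ?_, hSW ▸ hmem⟩
  · intro r
    simp only [hS, gramGen, Prod.fst_sum, Prod.snd_sum, Finset.sum_apply]
    calc _ ≤ ∑ i : Fin m, δ := by
          refine Finset.sum_le_sum fun i _ => ?_
          simp only [Pi.zero_apply, add_zero]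
          refine (Finset.sum_le_univ_sum_of_nonneg fun _ => by positivity).trans ?_
          rw [Finset.sum_eq_single i]
          · simp [Real.sq_sqrt hδ.le]
          · intro i' _ h; simp [h]
          · simp
      _ = _ := by simp
  · intro j
    simp only [hS, gramGen, Prod.snd_sum, Finset.sum_apply]
    calc _ ≤ ∑ i : Fin m, δ := by
          refine Finset.sum_le_sum fun i _ => ?_
          simp only [norm_div, Complex.norm_real, Real.norm_eq_abs, div_pow, sq_abs,
            Real.sq_sqrt hδ.le]
          rw [div_le_iff₀ hδ, ← sq]
          exact pow_le_pow_left₀ (norm_nonneg _) (hW i j) 2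
      _ = _ := by simp

/-- The substitution `u_i → u_i / √P_i`, `v_j → v_j / √q_j` turns the right-hand side into at most
`1 + 1` for unit vectors, so half of the rescaled `Y` is a contraction. Where a weight vanishes,
scaling the corresponding variable shows that `Y` vanishes as well. -/
lemma exists_contraction_of_pairing_le {P : Fin m → ℝ} {q : Fin n → ℝ} (hP : ∀ i, 0 ≤ P i)
    (hq : ∀ j, 0 ≤ q j) {Y : Matrix (Fin m) (Fin n) ℂ}
    (h : ∀ (u : Fin m → ℂ) (v : Fin n → ℂ), 0 ≤ (pair (fun i j => u i * v j) Y).re + ∑ i, P i * ‖u i‖ ^ 2 +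
      ∑ j, q j * ‖v j‖ ^ 2) :
    ∃ A : Matrix (Fin m) (Fin n) ℂ, opNorm A ≤ 1 ∧
      ∀ i j, Y i j = 2 * (((√(P i) : ℝ) : ℂ) * A i j * ((√(q j) : ℝ) : ℂ)) := by
  have h' : ∀ (u : Fin m → ℂ) (v : Fin n → ℂ), ‖pair (fun i j => u i * v j) Y‖ ≤ ∑ i, P i * ‖u i‖ ^ 2 +
      ∑ j, q j * ‖v j‖ ^ 2 := by
    intro u v
    set z := pair (fun i j => u i * v j) Y with hz
    -- Rotating `u` by a phase leaves the quadratic terms unchanged and makes the pairing equal to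
    -- minus its modulus.
    obtain ⟨w, hw, hwz⟩ : ∃ w : ℂ, ‖w‖ = 1 ∧ w * z = -(‖z‖ : ℂ) := by
      by_cases h0 : z = 0
      · exact ⟨1, by simp, by simp [h0]⟩
      · refine ⟨-((‖z‖ : ℂ) / z), by simp [h0], by field_simp⟩
    have h1 := h (fun i => w * u i) v
    have h2 : pair (fun i j => w * u i * v j) Y = w * z := by
      simp only [hz, pair, Finset.mul_sum, mul_assoc]
    rw [h2, hwz] at h1
    simp only [norm_mul, hw, one_mul, Complex.neg_re, Complex.ofReal_re] at h1
    linarith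
  have hent : ∀ (i j) (a b : ℝ), ‖Y i j‖ * (a * b) ≤ P i * a ^ 2 + q j * b ^ 2 := by
    intro i j a b
    have := h' (Pi.single i (a : ℂ)) (Pi.single j (b : ℂ))
    have e : pair (fun i' j' => (Pi.single i (a : ℂ) : Fin m → ℂ) i' *
        (Pi.single j (b : ℂ) : Fin n → ℂ) j') Y = a * b * Y i j := by
      simp [pair, Pi.single_apply]
    have e1 : ∑ i', P i' * ‖(Pi.single i (a : ℂ) : Fin m → ℂ) i'‖ ^ 2 = P i * a ^ 2 := by
      rw [Finset.sum_eq_single i] <;> simp +contextual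
    have e2 : ∑ j', q j' * ‖(Pi.single j (b : ℂ) : Fin n → ℂ) j'‖ ^ 2 = q j * b ^ 2 := by
      rw [Finset.sum_eq_single j] <;> simp +contextual
    rw [e, e1, e2] at this
    simp only [norm_mul, Complex.norm_real, Real.norm_eq_abs] at this
    refine le_trans ?_ this
    rw [mul_comm, ← abs_mul]
    exact mul_le_mul_of_nonneg_right (le_abs_self _) (norm_nonneg _)
  have hzero : ∀ i j, P i = 0 ∨ q j = 0 → Y i j = 0 := by
    intro i j hpq
    by_contra hY
    have hY' : 0 < ‖Y i j‖ := norm_pos_iff.2 hY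
    rcases hpq with h0 | h0
    · have := hent i j ((q j + 1) / ‖Y i j‖) 1
      rw [h0] at this; field_simp at this; linarith [pow_pos hY' 2]
    · have := hent i j 1 ((P i + 1) / ‖Y i j‖)
      rw [h0] at this; field_simp at this; linarith [pow_pos hY' 2]
  -- If a weight is zero the quotient is `0` by convention, in agreement with `hzero`.
  refine ⟨fun i j => Y i j / (2 * ((√(P i) : ℝ) : ℂ) * ((√(q j) : ℝ) : ℂ)), ?_, ?_⟩
  · refine opNorm_le_of_bilin fun u v hu hv => ?_
    have h3 := h' (fun i => u i / ((√(P i) : ℝ) : ℂ)) (fun j => v j / ((√(q j) : ℝ) : ℂ))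
    have e : ∑ i, ∑ j, u i * (Y i j / (2 * ((√(P i) : ℝ) : ℂ) * ((√(q j) : ℝ) : ℂ))) * v j =
        (1 / 2) * pair (fun i j => u i / ((√(P i) : ℝ) : ℂ) * (v j / ((√(q j) : ℝ) : ℂ))) Y := by
      simp only [pair, Finset.mul_sum]
      refine Finset.sum_congr rfl fun i _ => Finset.sum_congr rfl fun j _ => ?_
      simp only [div_eq_mul_inv, mul_inv]; ring
    have key : ∀ (t : ℝ) (z : ℂ), 0 ≤ t → t * ‖z / ((√t : ℝ) : ℂ)‖ ^ 2 ≤ ‖z‖ ^ 2 := by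
      intro t z ht
      rw [norm_div, Complex.norm_real, Real.norm_eq_abs, div_pow, sq_abs, Real.sq_sqrt ht]
      rcases ht.eq_or_lt with h0 | h0
      · rw [← h0]; simp
      · rw [mul_div_cancel₀ _ h0.ne']
    have h4 := h3.trans (add_le_add
      ((Finset.sum_le_sum fun i _ => key (P i) (u i) (hP i)).trans hu)
      ((Finset.sum_le_sum fun j _ => key (q j) (v j) (hq j)).trans hv))
    rw [e, norm_mul]
    norm_num
    linarith
  · intro i j
    by_cases h0 : P i = 0 ∨ q j = 0
    · simp [hzero i j h0]
    · push Not at h0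
      have h1 : ((√(P i) : ℝ) : ℂ) ≠ 0 := by
        exact_mod_cast (Real.sqrt_pos.2 ((hP i).lt_of_ne' h0.1)).ne'
      have h2 : ((√(q j) : ℝ) : ℂ) ≠ 0 := by
        exact_mod_cast (Real.sqrt_pos.2 ((hq j).lt_of_ne' h0.2)).ne'
      field_simp

theorem mem_closure_gramCone (π : Fin m → R) (X : Matrix (Fin m) (Fin n) ℂ) {N : ℝ}
    (h : ∀ (A : Matrix (Fin m) (Fin n) ℂ) (p : R → ℝ) (q : Fin n → ℝ), opNorm A ≤ 1 →
      (∀ r, 0 ≤ p r) → (∀ j, 0 ≤ q j) →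
      2 * ‖pair X (fun i j => ((√(p (π i)) : ℝ) : ℂ) * A i j * ((√(q j) : ℝ) : ℂ))‖ ≤
        N * (∑ r, p r + ∑ j, q j)) :
    ((fun i j => X i j, fun _ => N, fun _ => N) :
      (Fin m → Fin n → ℂ) × (R → ℝ) × (Fin n → ℝ)) ∈ closure (gramCone m n π : Set _) := by
  refine mem_closure_hull fun f hf => ?_
  obtain ⟨Y, hY⟩ := exists_re_pair (f.toLinearMap ∘ₗ LinearMap.inl ℝ _ _)
  set p : R → ℝ := fun r => f (0, Pi.single r 1, 0) with hp
  set q : Fin n → ℝ := fun j => f (0, 0, Pi.single j 1) with hq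
  have hfe : ∀ Z a b, f (Z, a, b) = (pair Z Y).re + ∑ r, a r * p r + ∑ j, b j * q j := by
    intro Z a b
    have e : ((Z, a, b) : (Fin m → Fin n → ℂ) × (R → ℝ) × (Fin n → ℝ)) =
        (Z, 0, 0) + ∑ r, a r • (0, Pi.single r 1, 0) + ∑ j, b j • (0, 0, Pi.single j 1) := by
      refine Prod.ext ?_ (Prod.ext ?_ ?_)
      · simp [Prod.fst_sum]
      · ext r; simp [Prod.fst_sum, Prod.snd_sum, Finset.sum_apply, Pi.single_apply]
      · ext r; simp [Prod.snd_sum, Finset.sum_apply, Pi.single_apply]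
    rw [e, map_add, map_add, map_sum, map_sum]
    simp only [map_smul, smul_eq_mul]
    rw [← hY]; rfl
  -- The slack in `gramGen` is needed here because a fiber of `π` may be empty. For `q` the
  -- generators with `u = 0` suffice.
  have hp0 : ∀ r, 0 ≤ p r := by
    intro r
    refine hf _ ⟨0, 0, Pi.single r 1, Pi.single_nonneg.2 zero_le_one, ?_⟩
    refine Prod.ext ?_ (Prod.ext ?_ ?_)
    · ext i j; simp [gramGen]
    · ext r'; simp [gramGen]
    · ext j; simp [gramGen]
  have hq0 : ∀ j, 0 ≤ q j := by
    intro j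
    refine hf _ ⟨0, Pi.single j 1, 0, le_rfl, ?_⟩
    refine Prod.ext ?_ (Prod.ext ?_ ?_)
    · ext i j; simp [gramGen]
    · ext r'; simp [gramGen]
    · ext j'; by_cases hj : j' = j <;> simp [gramGen, hj, Pi.single_apply]
  obtain ⟨A, hA, hYA⟩ := exists_contraction_of_pairing_le (P := fun i => p (π i)) (q := q) (Y := Y)
    (fun i => hp0 _) hq0 (by
      intro u v
      have := hf _ ⟨u, v, 0, le_rfl, rfl⟩
      rw [gramGen, hfe] at this
      simp only [Pi.zero_apply, add_zero] at this
      have e : ∑ r, (∑ i with π i = r, ‖u i‖ ^ 2) * p r = ∑ i, p (π i) * ‖u i‖ ^ 2 := by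
        rw [← Finset.sum_fiberwise Finset.univ π]
        refine Finset.sum_congr rfl fun r _ => ?_
        rw [Finset.sum_mul]
        refine Finset.sum_congr rfl fun i hi => ?_
        rw [(Finset.mem_filter.1 hi).2, mul_comm]
      rw [e] at this
      simpa only [mul_comm (q _)] using this)
  rw [hfe]
  have h1 := h A p q hA hp0 hq0
  have h2 : pair X Y = 2 * pair X (fun i j => ((√(p (π i)) : ℝ) : ℂ) * A i j * ((√(q j) : ℝ) : ℂ)) := by
    simp only [pair, hYA, Finset.mul_sum]
    refine Finset.sum_congr rfl fun i _ => Finset.sum_congr rfl fun j _ => ?_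
    ring
  have h3 := (abs_le.1 (Complex.abs_re_le_norm (pair X Y))).1
  rw [h2, norm_mul, Complex.norm_ofNat, ← h2] at h3
  have h4 : N * (∑ r, p r + ∑ j, q j) = ∑ r, N * p r + ∑ j, N * q j := by
    rw [mul_add, Finset.mul_sum, Finset.mul_sum]
  change 0 ≤ (pair X Y).re + ∑ r, N * p r + ∑ j, N * q j
  linarith

/-- The map `π` treats two cases at once: `π = id` bounds each `x_i` separately, and a constant `π`
bounds the whole family in `ℓ²`. The factor `2` and the sum `∑ p + ∑ q` in the hypothesis are the
two sides of the arithmetic-geometric mean inequality. -/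
theorem exists_smul_gram (π : Fin m → R) (X : Matrix (Fin m) (Fin n) ℂ) {N c : ℝ} (hN : 0 ≤ N)
    (hc : N < c)
    (h : ∀ (A : Matrix (Fin m) (Fin n) ℂ) (p : R → ℝ) (q : Fin n → ℝ), opNorm A ≤ 1 →
      (∀ r, 0 ≤ p r) → (∀ j, 0 ≤ q j) →
      2 * ‖pair X (fun i j => ((√(p (π i)) : ℝ) : ℂ) * A i j * ((√(q j) : ℝ) : ℂ))‖ ≤
        N * (∑ r, p r + ∑ j, q j)) :
    ∃ Z ∈ gramSet π, X = (c : ℂ) • Z := by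
  -- The diagonal bounds are at most `N + δ` from the approximation plus `m * δ` from the correction
  -- of its error, together exactly `c`.
  set δ := (c - N) / (m + 1) with hδ
  have hδ0 : 0 < δ := by have := sub_pos.2 hc; positivity
  obtain ⟨⟨Z, a, b⟩, hmem, hdist⟩ := Metric.mem_closure_iff.1 (mem_closure_gramCone π X h) δ hδ0
  rw [Prod.dist_eq, Prod.dist_eq, max_lt_iff, max_lt_iff] at hdist
  obtain ⟨h1, h2, h3⟩ := hdist
  rw [dist_pi_lt_iff hδ0] at h1 h2 h3
  obtain ⟨a', b', ha', hb', hmem'⟩ := small_mem_gramCone π hδ0 (W := (fun i j => X i j) - Z) (by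
    intro i j
    have := (dist_pi_lt_iff hδ0).1 (h1 i) j
    rw [dist_eq_norm] at this
    exact this.le)
  obtain ⟨d, x, y, hxy, hx, hy⟩ := exists_of_mem_gramCone (Submodule.add_mem _ hmem hmem')
  have hcδ : N + δ + m * δ = c := by rw [hδ]; field_simp; ring
  have hc0 : 0 < c := hN.trans_lt hc
  have hcs : ((√c : ℝ) : ℂ) ≠ 0 := by exact_mod_cast (Real.sqrt_pos.2 hc0).ne'
  have hcs2 : (c : ℂ) = ((√c : ℝ) : ℂ) * ((√c : ℝ) : ℂ) := by
    rw [← Complex.ofReal_mul, Real.mul_self_sqrt hc0.le]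
  have hx' : ∀ r, ∑ i with π i = r, ∑ k, ‖x i k‖ ^ 2 ≤ c := by
    intro r
    refine (hx r).trans ?_
    have := (abs_lt.1 (h2 r)).1
    have := ha' r
    simp only [Pi.add_apply]
    linarith
  have hy' : ∀ j, ∑ k, ‖y j k‖ ^ 2 ≤ c := by
    intro r
    refine (hy r).trans ?_
    have := (abs_lt.1 (h3 r)).1
    have := hb' r
    simp only [Pi.add_apply]
    linarith
  refine ⟨Matrix.of fun i j => ∑ k, x i k / ((√c : ℝ) : ℂ) * (y j k / ((√c : ℝ) : ℂ)),
    ⟨d, fun i k => x i k / ((√c : ℝ) : ℂ), fun j k => y j k / ((√c : ℝ) : ℂ),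
      fun _ _ => rfl, ?_, ?_⟩, ?_⟩
  · intro r
    simp only [norm_div, Complex.norm_real, Real.norm_eq_abs, div_pow, sq_abs,
      Real.sq_sqrt hc0.le, ← Finset.sum_div]
    exact (div_le_one hc0).2 (hx' r)
  · intro j
    simp only [norm_div, Complex.norm_real, Real.norm_eq_abs, div_pow, sq_abs,
      Real.sq_sqrt hc0.le, ← Finset.sum_div]
    exact (div_le_one hc0).2 (hy' j)
  · ext i j
    have := hxy i j
    simp only [Pi.add_apply, Pi.sub_apply, add_sub_cancel] at this
    rw [this, Matrix.smul_apply, Matrix.of_apply, smul_eq_mul, Finset.mul_sum]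
    refine Finset.sum_congr rfl fun k _ => ?_
    rw [hcs2]; field_simp

end Cone

/-! ### The `p`-norms for `p = 1, 2, ∞` -/

section PNorm

variable {k : ℕ}

lemma pNorm_nonneg {p : ℝ≥0∞} [Fact (1 ≤ p)] (v : Fin k → ℂ) : 0 ≤ pNorm p v := norm_nonneg _

lemma pNorm_one (v : Fin k → ℂ) : pNorm 1 v = ∑ i, ‖v i‖ := by
  simp [pNorm, PiLp.norm_eq_of_L1]

lemma pNorm_two (v : Fin k → ℂ) : pNorm 2 v = √(∑ i, ‖v i‖ ^ 2) := by
  simp [pNorm, EuclideanSpace.norm_eq]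

lemma pNorm_two_sq (v : Fin k → ℂ) : pNorm 2 v ^ 2 = ∑ i, ‖v i‖ ^ 2 := by
  rw [pNorm_two, Real.sq_sqrt (by positivity)]

lemma pNorm_top (v : Fin k → ℂ) : pNorm ∞ v = ⨆ i, ‖v i‖ := by
  simp [pNorm, PiLp.norm_eq_ciSup]

lemma le_pNorm_top (v : Fin k → ℂ) (i : Fin k) : ‖v i‖ ≤ pNorm ∞ v := by
  rw [pNorm_top]; exact le_ciSup (f := fun i => ‖v i‖) (Set.finite_range _).bddAbove i

lemma pNorm_top_le {v : Fin k → ℂ} {c : ℝ} (hc : 0 ≤ c) (h : ∀ i, ‖v i‖ ≤ c) : pNorm ∞ v ≤ c := by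
  rw [pNorm_top]; exact Real.iSup_le h hc

lemma pNorm_top_le_one_iff {v : Fin k → ℂ} : pNorm ∞ v ≤ 1 ↔ ∀ i, ‖v i‖ ≤ 1 :=
  ⟨fun h i => (le_pNorm_top v i).trans h, pNorm_top_le zero_le_one⟩

lemma pNorm_two_le_one_iff {v : Fin k → ℂ} : pNorm 2 v ≤ 1 ↔ ∑ i, ‖v i‖ ^ 2 ≤ 1 := by
  rw [pNorm_two, Real.sqrt_le_one]

lemma inDualBall_one_iff {f : Fin k → ℂ} : InDualBall 1 f ↔ ∀ i, ‖f i‖ ≤ 1 := by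
  constructor
  · intro h i
    have := h (Pi.single i 1)
    rw [pNorm_one, Finset.sum_eq_single i (by simp +contextual) (by simp)] at this
    simpa using this
  · intro h z
    rw [pNorm_one]
    refine (norm_sum_le _ _).trans (Finset.sum_le_sum fun i _ => ?_)
    rw [norm_mul]
    exact mul_le_of_le_one_left (norm_nonneg _) (h i)

lemma inDualBall_two_iff {f : Fin k → ℂ} : InDualBall 2 f ↔ ∑ i, ‖f i‖ ^ 2 ≤ 1 := by
  constructor
  · intro h
    have := sum_sq_le_one_of_pairing (w := f) zero_le_one fun u hu => by
      have := h u
      rw [dotProduct_comm] at this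
      exact this.trans (pNorm_two_le_one_iff.2 hu)
    simpa using this
  · intro h z
    rw [pNorm_two]
    refine (norm_sum_mul_le f z).trans ?_
    exact mul_le_of_le_one_left (Real.sqrt_nonneg _) (Real.sqrt_le_one.2 h)

lemma exists_phase (z : ℂ) : ∃ w : ℂ, ‖w‖ = 1 ∧ w * z = (‖z‖ : ℂ) := by
  by_cases h0 : z = 0
  · exact ⟨1, by simp, by simp [h0]⟩
  · exact ⟨(‖z‖ : ℂ) / z, by simp [h0], by field_simp⟩

lemma exists_norming_one (η : Fin k → ℂ) : ∃ f : Fin k → ℂ, (∀ i, ‖f i‖ ≤ 1) ∧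
    pNorm 1 η ≤ ‖f ⬝ᵥ η‖ := by
  choose f hf hfη using fun i => exists_phase (η i)
  refine ⟨f, fun i => (hf i).le, ?_⟩
  rw [dotProduct, Finset.sum_congr rfl fun i _ => hfη i, ← Complex.ofReal_sum, Complex.norm_real,
    pNorm_one]
  exact le_abs_self _

lemma exists_norming_two (η : Fin k → ℂ) : ∃ f : Fin k → ℂ, (∑ i, ‖f i‖ ^ 2 ≤ 1) ∧
    pNorm 2 η ≤ ‖f ⬝ᵥ η‖ := by
  rcases (pNorm_nonneg (p := 2) η).eq_or_lt with h0 | h0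
  · exact ⟨0, by simp, by rw [← h0]; positivity⟩
  · have hs := pNorm_two_sq η
    set s := pNorm 2 η
    have hs0 : (s : ℂ) ≠ 0 := by exact_mod_cast h0.ne'
    refine ⟨fun i => (s : ℂ)⁻¹ * star (η i), ?_, ?_⟩
    · simp only [norm_mul, norm_inv, Complex.norm_real, norm_star, mul_pow, ← Finset.mul_sum, ← hs,
        Real.norm_eq_abs, abs_of_pos h0]
      field_simp; exact le_rfl
    · have h3 : ∀ k, (s : ℂ)⁻¹ * star (η k) * η k = (s : ℂ)⁻¹ * ((‖η k‖ ^ 2 : ℝ) : ℂ) := by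
        intro k
        rw [mul_assoc, Complex.star_def, Complex.conj_mul']; push_cast; rfl
      have : (fun i => (s : ℂ)⁻¹ * star (η i)) ⬝ᵥ η = s := by
        simp only [dotProduct, h3, ← Finset.mul_sum, ← Complex.ofReal_sum, ← hs]
        push_cast; field_simp
      rw [this, Complex.norm_real]
      exact le_abs_self _

/-- The alternative `f = 0` covers `k = 0`, where there is no coordinate functional. -/
lemma exists_norming_top (η : Fin k → ℂ) : ∃ f : Fin k → ℂ, (f = 0 ∨ ∃ i, f = Pi.single i 1) ∧
    pNorm ∞ η ≤ ‖f ⬝ᵥ η‖ := by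
  rcases isEmpty_or_nonempty (Fin k) with h | h
  · exact ⟨0, Or.inl rfl, by rw [pNorm_top, Real.iSup_of_isEmpty]; positivity⟩
  · obtain ⟨i, hi⟩ := exists_eq_ciSup_of_finite (f := fun i => ‖η i‖)
    exact ⟨Pi.single i 1, Or.inr ⟨i, rfl⟩, by rw [pNorm_top, ← hi]; simp⟩

end PNorm

/-! ### Norms given as suprema of pairings -/

lemma pair_comm (X Y : Matrix (Fin m) (Fin n) ℂ) : pair X Y = pair Y X := by
  simp [pair, mul_comm]

lemma pair_add (X X' Y : Matrix (Fin m) (Fin n) ℂ) : pair (X + X') Y = pair X Y + pair X' Y := by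
  simp [pair, add_mul, Finset.sum_add_distrib]

lemma pair_smul (c : ℂ) (X Y : Matrix (Fin m) (Fin n) ℂ) : pair (c • X) Y = c * pair X Y := by
  simp [pair, Finset.mul_sum, mul_assoc]

lemma pair_smul_right (c : ℂ) (X Y : Matrix (Fin m) (Fin n) ℂ) :
    pair X (c • Y) = c * pair X Y := by
  rw [pair_comm, pair_smul, pair_comm]

lemma pair_single (X : Matrix (Fin m) (Fin n) ℂ) (i : Fin m) (j : Fin n) :
    pair X (Matrix.single i j 1) = X i j := by
  simp [pair, Matrix.single_apply, ite_and]

lemma pair_vecMulVec (η f : Fin m → ℂ) (ξ g : Fin n → ℂ) :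
    pair (Matrix.vecMulVec η ξ) (Matrix.vecMulVec f g) = (f ⬝ᵥ η) * (g ⬝ᵥ ξ) := by
  simp only [pair, Matrix.vecMulVec_apply, dotProduct, Finset.sum_mul_sum]
  exact Finset.sum_congr rfl fun i _ => Finset.sum_congr rfl fun j _ => by ring

lemma trace_conjTranspose_mul (X Y : Matrix (Fin m) (Fin n) ℂ) :
    (Yᴴ * X).trace = pair X (Y.map star) := by
  simp only [Matrix.trace, Matrix.diag, Matrix.mul_apply, Matrix.conjTranspose_apply, pair,
    Matrix.map_apply]
  rw [Finset.sum_comm]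
  simp [mul_comm]

lemma norm_pair_le_sum (X : Matrix (Fin m) (Fin n) ℂ) {Y : Matrix (Fin m) (Fin n) ℂ}
    (h : ∀ i j, ‖Y i j‖ ≤ 1) : ‖pair X Y‖ ≤ ∑ i, ∑ j, ‖X i j‖ := by
  refine (norm_sum_le _ _).trans (Finset.sum_le_sum fun i _ => (norm_sum_le _ _).trans
    (Finset.sum_le_sum fun j _ => ?_))
  rw [norm_mul]
  exact mul_le_of_le_one_right (norm_nonneg _) (h i j)

lemma map_star_map_star (Y : Matrix (Fin m) (Fin n) ℂ) : (Y.map star).map star = Y := by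
  ext i j; simp

/-- The value `c` is the supremum of the pairings of `X` with the elements of `𝒴`. -/
def IsPairSup (𝒴 : Set (Matrix (Fin m) (Fin n) ℂ)) (X : Matrix (Fin m) (Fin n) ℂ) (c : ℝ) : Prop :=
  IsLUB {t | ∃ Y ∈ 𝒴, t = ‖pair X Y‖} c

lemma IsPairSup.le {𝒴 : Set (Matrix (Fin m) (Fin n) ℂ)} {X : Matrix (Fin m) (Fin n) ℂ} {c : ℝ}
    (h : IsPairSup 𝒴 X c) {Y : Matrix (Fin m) (Fin n) ℂ} (hY : Y ∈ 𝒴) : ‖pair X Y‖ ≤ c :=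
  h.1 ⟨Y, hY, rfl⟩

lemma IsPairSup.le_of {𝒴 : Set (Matrix (Fin m) (Fin n) ℂ)} {X : Matrix (Fin m) (Fin n) ℂ}
    {c b : ℝ} (h : IsPairSup 𝒴 X c) (hb : ∀ Y ∈ 𝒴, ‖pair X Y‖ ≤ b) : c ≤ b :=
  h.2 (by rintro _ ⟨Y, hY, rfl⟩; exact hb Y hY)

lemma IsPairSup.nonneg {𝒴 : Set (Matrix (Fin m) (Fin n) ℂ)} {X : Matrix (Fin m) (Fin n) ℂ}
    {c : ℝ} (h : IsPairSup 𝒴 X c) : 0 ≤ c := by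
  obtain ⟨_, Y, hY, rfl⟩ := h.nonempty
  exact (norm_nonneg _).trans (h.le hY)

lemma bddAbove_of_pair {𝒴 : Set (Matrix (Fin m) (Fin n) ℂ)} {X : Matrix (Fin m) (Fin n) ℂ}
    {T : Set ℝ} (hT : ∀ t ∈ T, ∀ C, (∀ Y ∈ 𝒴, ‖pair X Y‖ ≤ C) → t ≤ C)
    (h𝒴 : ∀ Y ∈ 𝒴, ∀ i j, ‖Y i j‖ ≤ 1) : BddAbove T :=
  ⟨∑ i, ∑ j, ‖X i j‖, fun t ht => hT t ht _ fun Y hY => norm_pair_le_sum X (h𝒴 Y hY)⟩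

/-- The defining set `T` need not consist of single pairings. It suffices that each of its elements
is bounded by every bound for the pairings, and that each pairing is dominated by an element of `T`.
The entrywise bound on `𝒴` makes `T` bounded, so that `sSup` is a genuine supremum. -/
lemma isPairSup_sSup {𝒴 : Set (Matrix (Fin m) (Fin n) ℂ)} {X : Matrix (Fin m) (Fin n) ℂ}
    {T : Set ℝ} (hne : T.Nonempty) (hT : ∀ t ∈ T, ∀ C, (∀ Y ∈ 𝒴, ‖pair X Y‖ ≤ C) → t ≤ C)
    (hT' : ∀ Y ∈ 𝒴, ∃ t ∈ T, ‖pair X Y‖ ≤ t) (h𝒴 : ∀ Y ∈ 𝒴, ∀ i j, ‖Y i j‖ ≤ 1) :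
    IsPairSup 𝒴 X (sSup T) := by
  constructor
  · rintro _ ⟨Y, hY, rfl⟩
    obtain ⟨t, ht, hle⟩ := hT' Y hY
    exact hle.trans (le_csSup (bddAbove_of_pair hT h𝒴) ht)
  · intro C hC
    exact csSup_le hne fun t ht => hT t ht C fun Y hY => hC ⟨Y, hY, rfl⟩

/-- Matrix units in `𝒴` give definiteness, since pairing with them reads off the entries. -/
lemma isMatrixNorm_of_isPairSup {𝒴 : Set (Matrix (Fin m) (Fin n) ℂ)}
    {N : Matrix (Fin m) (Fin n) ℂ → ℝ} (h : ∀ X, IsPairSup 𝒴 X (N X))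
    (hs : ∀ i j, Matrix.single i j 1 ∈ 𝒴) : IsMatrixNorm N := by
  have hle : ∀ (c : ℂ) X, N (c • X) ≤ ‖c‖ * N X := fun c X => (h _).le_of fun Y hY => by
    rw [pair_smul, norm_mul]
    exact mul_le_mul_of_nonneg_left ((h X).le hY) (norm_nonneg _)
  refine ⟨fun X hX => ?_, fun X Y => ?_, fun c X => ?_⟩
  · ext i j
    have := (h X).le (hs i j)
    rw [hX, pair_single] at this
    simpa using this
  · refine (h _).le_of fun W hW => ?_
    rw [pair_add]
    exact (norm_add_le _ _).trans (add_le_add ((h X).le hW) ((h Y).le hW))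
  · refine le_antisymm (hle c X) ?_
    by_cases hc : c = 0
    · simpa [hc] using (h 0).nonneg
    · have := hle c⁻¹ (c • X)
      rw [smul_smul, inv_mul_cancel₀ hc, one_smul, norm_inv] at this
      rwa [← le_inv_mul_iff₀ (norm_pos_iff.2 hc)]

/-- On rank one tensors the pairing factorizes, so tensors of norming functionals lying in `𝒴` give
the lower bound. -/
lemma isCrossNorm_of_isPairSup {p r : ℝ≥0∞} [Fact (1 ≤ p)] [Fact (1 ≤ r)]
    {𝒴 : Set (Matrix (Fin m) (Fin n) ℂ)}
    {N : Matrix (Fin m) (Fin n) ℂ → ℝ} (h : ∀ X, IsPairSup 𝒴 X (N X))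
    (hs : ∀ i j, Matrix.single i j 1 ∈ 𝒴) {K : Set (Fin m → ℂ)} {L : Set (Fin n → ℂ)}
    (hK : ∀ η, ∃ f ∈ K, pNorm p η ≤ ‖f ⬝ᵥ η‖) (hL : ∀ ξ, ∃ g ∈ L, pNorm r ξ ≤ ‖g ⬝ᵥ ξ‖)
    (hKL : ∀ f ∈ K, ∀ g ∈ L, Matrix.vecMulVec f g ∈ 𝒴)
    (hle : ∀ η ξ, ∀ Y ∈ 𝒴, ‖pair (Matrix.vecMulVec η ξ) Y‖ ≤ pNorm p η * pNorm r ξ) :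
    IsCrossNorm p r N := by
  refine ⟨isMatrixNorm_of_isPairSup h hs, fun η ξ => le_antisymm ((h _).le_of (hle η ξ)) ?_⟩
  obtain ⟨f, hf, hfη⟩ := hK η
  obtain ⟨g, hg, hgξ⟩ := hL ξ
  refine le_trans ?_ ((h _).le (hKL f hf g hg))
  rw [pair_vecMulVec, norm_mul]
  exact mul_le_mul hfη hgξ (pNorm_nonneg _) (norm_nonneg _)

/-! ### Dual systems -/

/-- Two functions `N` and `D`, given as suprema of pairings with `𝒴` and with `G`, where `G` is
the unit ball of `N` up to closure. -/
structure DualSystem (𝒴 G : Set (Matrix (Fin m) (Fin n) ℂ))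
    (N D : Matrix (Fin m) (Fin n) ℂ → ℝ) : Prop where
  lubN : ∀ X, IsPairSup 𝒴 X (N X)
  lubD : ∀ X, IsPairSup G X (D X)
  le_one : ∀ Z ∈ G, N Z ≤ 1
  exists_smul : ∀ (X) (c : ℝ), N X < c → ∃ Z ∈ G, X = (c : ℂ) • Z
  star_mem : ∀ Z ∈ G, Z.map star ∈ G

namespace DualSystem

variable {𝒴 G : Set (Matrix (Fin m) (Fin n) ℂ)} {N D : Matrix (Fin m) (Fin n) ℂ → ℝ}

/-- The representation `X = c Z` with `Z ∈ G` is available only for `c` strictly above `N X`; the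
estimate is carried to the limit `c ↓ N X`. -/
lemma norm_pair_le (h : DualSystem 𝒴 G N D) (X Y : Matrix (Fin m) (Fin n) ℂ) :
    ‖pair X Y‖ ≤ N X * D Y := by
  have hD := (h.lubD Y).nonneg
  have key : ∀ c, N X < c → ‖pair X Y‖ ≤ c * D Y := by
    intro c hc
    obtain ⟨Z, hZ, rfl⟩ := h.exists_smul X c hc
    rw [pair_smul, norm_mul, Complex.norm_real, Real.norm_eq_abs,
      abs_of_pos ((h.lubN _).nonneg.trans_lt hc), pair_comm]
    exact mul_le_mul_of_nonneg_left ((h.lubD Y).le hZ) ((h.lubN _).nonneg.trans hc.le)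
  have hlim : Filter.Tendsto (fun c => c * D Y) (nhdsWithin (N X) (Set.Ioi (N X)))
      (nhds (N X * D Y)) :=
    ((continuous_mul_const (D Y)).tendsto _).mono_left nhdsWithin_le_nhds
  exact ge_of_tendsto hlim (Filter.eventually_of_mem self_mem_nhdsWithin key)

/-- The trace `Tr (Y* X)` is a pairing with the entrywise conjugate of `Y`, so the dualities need
invariance of `D` under conjugation. -/
lemma map_star_le (h : DualSystem 𝒴 G N D) (Y : Matrix (Fin m) (Fin n) ℂ) :
    D (Y.map star) ≤ D Y := by
  refine (h.lubD _).le_of fun Z hZ => ?_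
  have := (h.lubD Y).le (h.star_mem Z hZ)
  have e : pair (Y.map star) Z = star (pair Y (Z.map star)) := by simp [pair]
  rwa [e, norm_star]

lemma isPairSup_ball (h : DualSystem 𝒴 G N D) (Y : Matrix (Fin m) (Fin n) ℂ) :
    IsPairSup {X | N X ≤ 1} Y (D Y) := by
  constructor
  · rintro _ ⟨X, hX, rfl⟩
    rw [pair_comm]
    exact (h.norm_pair_le X Y).trans (mul_le_of_le_one_left (h.lubD Y).nonneg hX)
  · intro b hb
    exact (h.lubD Y).le_of fun Z hZ => hb ⟨Z, h.le_one Z hZ, rfl⟩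

lemma isConjDual_right (h : DualSystem 𝒴 G N D) : IsConjDual D N := by
  intro X
  constructor
  · rintro _ ⟨Y, hY, rfl⟩
    rw [trace_conjTranspose_mul]
    have e : pair X (Y.map star) = star (pair Y (X.map star)) := by simp [pair, mul_comm]
    rw [e, norm_star]
    exact (h.norm_pair_le Y _).trans
      ((mul_le_of_le_one_left (h.lubD _).nonneg hY).trans (h.map_star_le X))
  · intro b hb
    refine (h.lubD X).le_of fun Z hZ => hb ⟨Z.map star, h.le_one _ (h.star_mem Z hZ), ?_⟩
    rw [trace_conjTranspose_mul, map_star_map_star]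

/-- Elements of `𝒴` have `D` at most `1`, because `N` is at most `1` on `G`; hence the supremum over
the unit ball of `D` already reaches `N X`. -/
lemma isConjDual_left (h : DualSystem 𝒴 G N D) : IsConjDual N D := by
  intro X
  constructor
  · rintro _ ⟨Y, hY, rfl⟩
    rw [trace_conjTranspose_mul]
    exact (h.norm_pair_le X _).trans
      (mul_le_of_le_one_right (h.lubN X).nonneg ((h.map_star_le Y).trans hY))
  · intro b hb
    refine (h.lubN X).le_of fun Y hY => hb ⟨Y.map star, ?_, ?_⟩
    · refine (h.map_star_le Y).trans ((h.lubD Y).le_of fun Z hZ => ?_)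
      rw [pair_comm]
      exact ((h.lubN Z).le hY).trans (h.le_one Z hZ)
    · rw [trace_conjTranspose_mul, map_star_map_star]

end DualSystem

/-! ### Gram matrices -/

/-- Gram matrices of two families in unit balls. -/
abbrev gramId (m n : ℕ) : Set (Matrix (Fin m) (Fin n) ℂ) := gramSet (id : Fin m → Fin m)

/-- Gram matrices of a family in the unit ball of `ℓ²(H)` and a family in the unit ball of `H`. -/
abbrev gramUnit (m n : ℕ) : Set (Matrix (Fin m) (Fin n) ℂ) := gramSet (fun _ : Fin m => ())

lemma mem_gramSet_of_fintype {R : Type} [DecidableEq R] {π : Fin m → R} {κ : Type*} [Fintype κ]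
    {Z : Matrix (Fin m) (Fin n) ℂ} {x : Fin m → κ → ℂ} {y : Fin n → κ → ℂ}
    (hZ : ∀ i j, Z i j = ∑ k, x i k * y j k) (hx : ∀ r, ∑ i with π i = r, ∑ k, ‖x i k‖ ^ 2 ≤ 1)
    (hy : ∀ j, ∑ k, ‖y j k‖ ^ 2 ≤ 1) : Z ∈ gramSet π := by
  let e := (Fintype.equivFin κ).symm
  refine ⟨Fintype.card κ, fun i k => x i (e k), fun j k => y j (e k), fun i j => ?_, fun r => ?_,
    fun j => ?_⟩
  · rw [hZ, e.sum_comp fun k => x i k * y j k]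
  · rw [Finset.sum_congr rfl fun i _ => e.sum_comp fun k => ‖x i k‖ ^ 2]
    exact hx r
  · rw [e.sum_comp fun k => ‖y j k‖ ^ 2]
    exact hy j

lemma mem_gramId {κ : Type*} [Fintype κ] {Z : Matrix (Fin m) (Fin n) ℂ} {x : Fin m → κ → ℂ}
    {y : Fin n → κ → ℂ} (hZ : ∀ i j, Z i j = ∑ k, x i k * y j k)
    (hx : ∀ i, ∑ k, ‖x i k‖ ^ 2 ≤ 1) (hy : ∀ j, ∑ k, ‖y j k‖ ^ 2 ≤ 1) : Z ∈ gramId m n :=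
  mem_gramSet_of_fintype hZ (fun r => by simpa [Finset.sum_filter] using hx r) hy

lemma mem_gramUnit {κ : Type*} [Fintype κ] {Z : Matrix (Fin m) (Fin n) ℂ} {x : Fin m → κ → ℂ}
    {y : Fin n → κ → ℂ} (hZ : ∀ i j, Z i j = ∑ k, x i k * y j k)
    (hx : ∑ i, ∑ k, ‖x i k‖ ^ 2 ≤ 1) (hy : ∀ j, ∑ k, ‖y j k‖ ^ 2 ≤ 1) : Z ∈ gramUnit m n :=
  mem_gramSet_of_fintype hZ (fun r => by simpa using hx) hy

lemma exists_of_mem_gramId {Z : Matrix (Fin m) (Fin n) ℂ} (h : Z ∈ gramId m n) :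
    ∃ (d : ℕ) (x : Fin m → Fin d → ℂ) (y : Fin n → Fin d → ℂ),
    (∀ i j, Z i j = ∑ k, x i k * y j k) ∧ (∀ i, ∑ k, ‖x i k‖ ^ 2 ≤ 1) ∧
    ∀ j, ∑ k, ‖y j k‖ ^ 2 ≤ 1 := by
  obtain ⟨d, x, y, h1, h2, h3⟩ := h
  exact ⟨d, x, y, h1, fun r => by simpa [Finset.sum_filter] using h2 r, h3⟩

lemma exists_of_mem_gramUnit {Z : Matrix (Fin m) (Fin n) ℂ} (h : Z ∈ gramUnit m n) :
    ∃ (d : ℕ) (x : Fin m → Fin d → ℂ) (y : Fin n → Fin d → ℂ),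
    (∀ i j, Z i j = ∑ k, x i k * y j k) ∧ (∑ i, ∑ k, ‖x i k‖ ^ 2 ≤ 1) ∧
    ∀ j, ∑ k, ‖y j k‖ ^ 2 ≤ 1 := by
  obtain ⟨d, x, y, h1, h2, h3⟩ := h
  exact ⟨d, x, y, h1, by simpa using h2 (), h3⟩

lemma star_mem_gramSet {R : Type} [DecidableEq R] {π : Fin m → R}
    {Z : Matrix (Fin m) (Fin n) ℂ} (h : Z ∈ gramSet π) : Z.map star ∈ gramSet π := by
  obtain ⟨d, x, y, h1, h2, h3⟩ := h
  exact ⟨d, fun i k => star (x i k), fun j k => star (y j k), fun i j => by simp [h1],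
    fun r => by simpa using h2 r, fun j => by simpa using h3 j⟩

lemma norm_le_one_of_mem_gramId {Z : Matrix (Fin m) (Fin n) ℂ} (h : Z ∈ gramId m n)
    (i : Fin m) (j : Fin n) : ‖Z i j‖ ≤ 1 := by
  obtain ⟨d, x, y, h1, h2, h3⟩ := exists_of_mem_gramId h
  rw [h1]
  simpa using norm_sum_mul_le_of_sq zero_le_one zero_le_one (by simpa using h2 i)
    (by simpa using h3 j)

lemma gramUnit_subset_gramId : gramUnit m n ⊆ gramId m n := by
  intro Z h
  obtain ⟨d, x, y, h1, h2, h3⟩ := exists_of_mem_gramUnit h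
  exact mem_gramId h1 (fun i => (Finset.single_le_sum
    (f := fun i => ∑ k, ‖x i k‖ ^ 2) (fun _ _ => by positivity) (Finset.mem_univ i)).trans h2) h3

lemma vecMulVec_mem_gramId {f : Fin m → ℂ} {g : Fin n → ℂ} (hf : ∀ i, ‖f i‖ ≤ 1)
    (hg : ∀ j, ‖g j‖ ≤ 1) : Matrix.vecMulVec f g ∈ gramId m n :=
  mem_gramId (κ := Unit) (x := fun i _ => f i) (y := fun j _ => g j)
    (by simp [Matrix.vecMulVec_apply]) (by simpa using hf) (by simpa using hg)

lemma vecMulVec_mem_gramUnit {f : Fin m → ℂ} {g : Fin n → ℂ} (hf : ∑ i, ‖f i‖ ^ 2 ≤ 1)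
    (hg : ∀ j, ‖g j‖ ≤ 1) : Matrix.vecMulVec f g ∈ gramUnit m n :=
  mem_gramUnit (κ := Unit) (x := fun i _ => f i) (y := fun j _ => g j)
    (by simp [Matrix.vecMulVec_apply]) (by simpa using hf) (by simpa using hg)

lemma single_eq_vecMulVec (i : Fin m) (j : Fin n) :
    (Matrix.single i j 1 : Matrix (Fin m) (Fin n) ℂ) =
      Matrix.vecMulVec (Pi.single i 1) (Pi.single j 1) := by
  ext i' j'
  simp [Matrix.single_apply, Matrix.vecMulVec_apply, Pi.single_apply, ite_and, eq_comm]
  split_ifs <;> rfl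

lemma norm_single_le_one {k : ℕ} (i i' : Fin k) : ‖(Pi.single i 1 : Fin k → ℂ) i'‖ ≤ 1 := by
  by_cases h : i' = i <;> simp [h]

lemma sum_norm_single_sq {κ : Type*} [Fintype κ] [DecidableEq κ] (i : κ) :
    ∑ i', ‖(Pi.single i 1 : κ → ℂ) i'‖ ^ 2 = 1 := by
  rw [Finset.sum_eq_single i] <;> simp +contextual

/-- Coordinate by coordinate the sum is the form of `A` on `(u_i x_i(k))` and `(y_j(k) v_j)`;
Cauchy–Schwarz in `k` finishes. Hypotheses on the weighted families serve both `gramId` and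
`gramUnit`, and general index types allow amplified matrices. -/
lemma norm_gram_bilin_le {ι κ : Type} [Fintype ι] [DecidableEq ι] [Fintype κ] [DecidableEq κ]
    {A : Matrix ι κ ℂ} (hA : opNorm A ≤ 1) {d : ℕ} {x : ι → Fin d → ℂ} {y : κ → Fin d → ℂ}
    {u : ι → ℂ} {v : κ → ℂ} (hx : ∑ i, ∑ k, ‖u i * x i k‖ ^ 2 ≤ 1)
    (hy : ∑ j, ∑ k, ‖y j k * v j‖ ^ 2 ≤ 1) :
    ‖∑ i, ∑ j, u i * ((∑ k, x i k * y j k) * A i j) * v j‖ ≤ 1 := by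
  have e : ∑ i, ∑ j, u i * ((∑ k, x i k * y j k) * A i j) * v j =
      ∑ k, ∑ i, ∑ j, (u i * x i k) * A i j * (y j k * v j) := by
    rw [Finset.sum_comm' (t' := Finset.univ) (s' := fun _ => Finset.univ) (by simp)]
    simp only [Finset.sum_mul, Finset.mul_sum]
    rw [Finset.sum_comm]
    have : ∀ i : ι, ∑ j : κ, ∑ k : Fin d, u i * (x i k * y j k * A i j) * v j =
        ∑ k, ∑ j, (u i * x i k) * A i j * (y j k * v j) := fun i => by
      rw [Finset.sum_comm]
      exact Finset.sum_congr rfl fun k _ => Finset.sum_congr rfl fun j _ => by ring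
    rw [Finset.sum_congr rfl fun i _ => this i, Finset.sum_comm]
  rw [e]
  calc _ ≤ ∑ k, √(∑ i, ‖u i * x i k‖ ^ 2) * √(∑ j, ‖y j k * v j‖ ^ 2) := by
        refine (norm_sum_le _ _).trans (Finset.sum_le_sum fun k _ => ?_)
        exact norm_bilin_le hA (Real.sqrt_nonneg _) (Real.sqrt_nonneg _)
          (Real.sq_sqrt (by positivity)).ge (Real.sq_sqrt (by positivity)).ge
    _ ≤ √(∑ k, √(∑ i, ‖u i * x i k‖ ^ 2) ^ 2) * √(∑ k, √(∑ j, ‖y j k * v j‖ ^ 2) ^ 2) :=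
        Real.sum_mul_le_sqrt_mul_sqrt _ _ _
    _ ≤ 1 * 1 := by
        have h1 : ∀ k, √(∑ i, ‖u i * x i k‖ ^ 2) ^ 2 = ∑ i, ‖u i * x i k‖ ^ 2 :=
          fun k => Real.sq_sqrt (by positivity)
        have h2 : ∀ k, √(∑ j, ‖y j k * v j‖ ^ 2) ^ 2 = ∑ j, ‖y j k * v j‖ ^ 2 :=
          fun k => Real.sq_sqrt (by positivity)
        simp only [h1, h2]
        rw [Finset.sum_comm] at hx hy
        exact mul_le_mul (Real.sqrt_le_one.2 hx) (Real.sqrt_le_one.2 hy) (Real.sqrt_nonneg _)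
          zero_le_one
    _ = 1 := one_mul 1

section OpNorm

variable {ι κ : Type} [Fintype ι] [DecidableEq ι] [Fintype κ] [DecidableEq κ]

lemma norm_bilin_le_opNorm_of_le_one (A : Matrix ι κ ℂ) {u : ι → ℂ} {v : κ → ℂ}
    (hu : ∑ i, ‖u i‖ ^ 2 ≤ 1) (hv : ∑ j, ‖v j‖ ^ 2 ≤ 1) :
    ‖∑ i, ∑ j, u i * A i j * v j‖ ≤ opNorm A := by
  refine (norm_bilin_le_opNorm A u v).trans (mul_le_of_le_one_right (opNorm_nonneg A) ?_)
  exact mul_le_one₀ (Real.sqrt_le_one.2 hu) (Real.sqrt_nonneg _) (Real.sqrt_le_one.2 hv)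

lemma opNorm_zero_le : opNorm (0 : Matrix ι κ ℂ) ≤ 1 :=
  opNorm_le_of_bilin fun u v _ _ => by simp

lemma opNorm_vecMulVec_le {f : ι → ℂ} {g : κ → ℂ} (hf : ∑ i, ‖f i‖ ^ 2 ≤ 1)
    (hg : ∑ j, ‖g j‖ ^ 2 ≤ 1) : opNorm (Matrix.vecMulVec f g) ≤ 1 := by
  refine opNorm_le_of_bilin fun u v hu hv => ?_
  have e : ∑ i, ∑ j, u i * Matrix.vecMulVec f g i j * v j =
      (∑ i, u i * f i) * ∑ j, g j * v j := by
    rw [Finset.sum_mul_sum]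
    exact Finset.sum_congr rfl fun i _ => Finset.sum_congr rfl fun j _ => by
      rw [Matrix.vecMulVec_apply]; ring
  rw [e, norm_mul]
  have h1 := norm_sum_mul_le_of_sq zero_le_one zero_le_one (u := u) (v := f) (by simpa using hu)
    (by simpa using hf)
  have h2 := norm_sum_mul_le_of_sq zero_le_one zero_le_one (u := g) (v := v) (by simpa using hg)
    (by simpa using hv)
  rw [mul_one] at h1 h2
  exact mul_le_one₀ h1 (norm_nonneg _) h2

end OpNorm

/-! ### The norms as suprema of pairings -/

/-- The matrices with entries `s_i A_ij t_j`, with unit vectors `s`, `t` and a contraction `A`. -/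
def schurSet (m n : ℕ) : Set (Matrix (Fin m) (Fin n) ℂ) :=
  {Y | ∃ (A : Matrix (Fin m) (Fin n) ℂ) (s : Fin m → ℂ) (t : Fin n → ℂ), opNorm A ≤ 1 ∧
    ∑ i, ‖s i‖ ^ 2 ≤ 1 ∧ ∑ j, ‖t j‖ ^ 2 ≤ 1 ∧ ∀ i j, Y i j = s i * A i j * t j}

/-- The matrices with entries `A_ij t_j`, with a unit vector `t` and a contraction `A`. -/
def columnSet (m n : ℕ) : Set (Matrix (Fin m) (Fin n) ℂ) :=
  {Y | ∃ (A : Matrix (Fin m) (Fin n) ℂ) (t : Fin n → ℂ), opNorm A ≤ 1 ∧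
    ∑ j, ‖t j‖ ^ 2 ≤ 1 ∧ ∀ i j, Y i j = A i j * t j}

lemma norm_entry_le {A : Matrix (Fin m) (Fin n) ℂ} (hA : opNorm A ≤ 1) (i : Fin m) (j : Fin n) :
    ‖A i j‖ ≤ 1 := by
  have := norm_bilin_le_opNorm_of_le_one A (sum_norm_single_sq i).le (sum_norm_single_sq j).le
  simp only [Pi.single_apply, ite_mul, one_mul, zero_mul, mul_ite, mul_one, mul_zero,
    Finset.sum_ite_eq', Finset.mem_univ, if_true] at this
  exact this.trans hA

lemma norm_le_one_of_sum_sq {k : ℕ} {s : Fin k → ℂ} (hs : ∑ i, ‖s i‖ ^ 2 ≤ 1) (i : Fin k) :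
    ‖s i‖ ≤ 1 := by
  have := (Finset.single_le_sum (f := fun i => ‖s i‖ ^ 2) (fun _ _ => by positivity)
    (Finset.mem_univ i)).trans hs
  exact (sq_le_one_iff₀ (norm_nonneg _)).1 this

lemma isPairSup_normS (X : Matrix (Fin m) (Fin n) ℂ) : IsPairSup (schurSet m n) X (normS X) := by
  refine isPairSup_sSup ⟨_, 0, opNorm_zero_le, rfl⟩ ?_ ?_ ?_
  · rintro _ ⟨A, hA, rfl⟩ C hC
    refine opNorm_le_of_bilin fun u v hu hv => ?_
    have := hC (fun i j => u i * A i j * v j) ⟨A, u, v, hA, hu, hv, fun _ _ => rfl⟩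
    convert this using 2
    exact Finset.sum_congr rfl fun i _ => Finset.sum_congr rfl fun j _ => by
      rw [Matrix.hadamard_apply]; ring
  · rintro Y ⟨A, s, t, hA, hs, ht, hY⟩
    refine ⟨_, ⟨A, hA, rfl⟩, ?_⟩
    refine le_trans (le_of_eq ?_) (norm_bilin_le_opNorm_of_le_one _ hs ht)
    congr 1
    exact Finset.sum_congr rfl fun i _ => Finset.sum_congr rfl fun j _ => by
      rw [Matrix.hadamard_apply, hY]; ring
  · rintro Y ⟨A, s, t, hA, hs, ht, hY⟩ i j
    rw [hY, norm_mul, norm_mul]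
    exact mul_le_one₀ (mul_le_one₀ (norm_le_one_of_sum_sq hs i) (norm_nonneg _)
      (norm_entry_le hA i j)) (norm_nonneg _) (norm_le_one_of_sum_sq ht j)

lemma sum_mul_columnSums (X A : Matrix (Fin m) (Fin n) ℂ) (t : Fin n → ℂ) :
    ∑ j, t j * columnSums X A j = pair X (fun i j => A i j * t j) := by
  simp only [columnSums, pair, Finset.mul_sum]
  rw [Finset.sum_comm]
  exact Finset.sum_congr rfl fun i _ => Finset.sum_congr rfl fun j _ => by ring

lemma isPairSup_normT (X : Matrix (Fin m) (Fin n) ℂ) : IsPairSup (columnSet m n) X (normT X) := by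
  refine isPairSup_sSup ⟨_, 0, opNorm_zero_le, rfl⟩ ?_ ?_ ?_
  · rintro _ ⟨A, hA, rfl⟩ C hC
    have h0 : 0 ≤ C := (norm_nonneg _).trans (hC 0 ⟨A, 0, hA, by simp, by simp⟩)
    rw [pNorm_two]
    refine sum_sq_le_one_of_pairing h0 fun t ht => ?_
    rw [sum_mul_columnSums]
    exact hC _ ⟨A, t, hA, ht, fun _ _ => rfl⟩
  · rintro Y ⟨A, t, hA, ht, hY⟩
    refine ⟨_, ⟨A, hA, rfl⟩, ?_⟩
    obtain rfl : Y = fun i j => A i j * t j := by ext i j; exact hY i j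
    rw [← sum_mul_columnSums, pNorm_two]
    exact (norm_sum_mul_le _ _).trans
      (mul_le_of_le_one_left (Real.sqrt_nonneg _) (Real.sqrt_le_one.2 ht))
  · rintro Y ⟨A, t, hA, ht, hY⟩ i j
    rw [hY, norm_mul]
    exact mul_le_one₀ (norm_entry_le hA i j) (norm_nonneg _) (norm_le_one_of_sum_sq ht j)

/-- The tensors `f ⊗ g` with `f ∈ K` and `g ∈ L`. -/
def tensorSet (K : Set (Fin m → ℂ)) (L : Set (Fin n → ℂ)) : Set (Matrix (Fin m) (Fin n) ℂ) :=
  {Y | ∃ f ∈ K, ∃ g ∈ L, Y = Matrix.vecMulVec f g}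

lemma isPairSup_injNorm {p r : ℝ≥0∞} (X : Matrix (Fin m) (Fin n) ℂ)
    (hp : ∀ f : Fin m → ℂ, InDualBall p f → ∀ i, ‖f i‖ ≤ 1)
    (hr : ∀ g : Fin n → ℂ, InDualBall r g → ∀ i, ‖g i‖ ≤ 1) [Fact (1 ≤ p)] [Fact (1 ≤ r)] :
    IsPairSup (tensorSet {f | InDualBall p f} {g | InDualBall r g}) X (injNorm p r X) := by
  have e : ∀ (f : Fin m → ℂ) (g : Fin n → ℂ),
      ‖∑ i, ∑ j, X i j * f i * g j‖ = ‖pair X (Matrix.vecMulVec f g)‖ := by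
    intro f g; simp [pair, Matrix.vecMulVec_apply, mul_assoc]
  refine isPairSup_sSup ⟨_, 0, 0, ?_, ?_, rfl⟩ ?_ ?_ ?_
  · intro z; simpa using pNorm_nonneg z
  · intro z; simpa using pNorm_nonneg z
  · rintro _ ⟨f, g, hf, hg, rfl⟩ C hC
    rw [e]
    exact hC _ ⟨f, hf, g, hg, rfl⟩
  · rintro Y ⟨f, hf, g, hg, rfl⟩
    exact ⟨_, ⟨f, g, hf, hg, rfl⟩, (e f g).ge⟩
  · rintro Y ⟨f, hf, g, hg, rfl⟩ i j
    rw [Matrix.vecMulVec_apply, norm_mul]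
    exact mul_le_one₀ (hp f hf i) (norm_nonneg _) (hr g hg j)

lemma norm_le_one_of_inDualBall_two {k : ℕ} (f : Fin k → ℂ) (hf : InDualBall 2 f) (i : Fin k) :
    ‖f i‖ ≤ 1 := norm_le_one_of_sum_sq (inDualBall_two_iff.1 hf) i

lemma norm_le_one_of_inDualBall_one {k : ℕ} (f : Fin k → ℂ) (hf : InDualBall 1 f) (i : Fin k) :
    ‖f i‖ ≤ 1 := inDualBall_one_iff.1 hf i

theorem normB_eq_injNorm (X : Matrix (Fin m) (Fin n) ℂ) : normB X = injNorm 1 1 X := by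
  unfold normB injNorm
  congr 1
  ext t
  simp only [inDualBall_one_iff, pNorm_top_le_one_iff, bilinForm, mul_comm (X _ _)]

lemma sum_mul_mulVec (X : Matrix (Fin m) (Fin n) ℂ) (f : Fin m → ℂ) (z : Fin n → ℂ) :
    ∑ i, f i * (X *ᵥ z) i = pair X (Matrix.vecMulVec f z) := by
  simp only [Matrix.mulVec, dotProduct, pair, Matrix.vecMulVec_apply, Finset.mul_sum]
  exact Finset.sum_congr rfl fun i _ => Finset.sum_congr rfl fun j _ => by ring

lemma isPairSup_normF (X : Matrix (Fin m) (Fin n) ℂ) :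
    IsPairSup (tensorSet {f | InDualBall 2 f} {g | InDualBall 1 g}) X (normF X) := by
  refine isPairSup_sSup ⟨_, 0, by simp [pNorm], rfl⟩ ?_ ?_ ?_
  · rintro _ ⟨z, hz, rfl⟩ C hC
    have hz' : InDualBall 1 z := inDualBall_one_iff.2 (pNorm_top_le_one_iff.1 hz)
    have h0 : 0 ≤ C := (norm_nonneg _).trans
      (hC _ ⟨0, inDualBall_two_iff.2 (by simp), z, hz', rfl⟩)
    rw [pNorm_two]
    refine sum_sq_le_one_of_pairing h0 fun u hu => ?_
    rw [sum_mul_mulVec]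
    exact hC _ ⟨u, inDualBall_two_iff.2 hu, z, hz', rfl⟩
  · rintro Y ⟨f, hf, g, hg, rfl⟩
    refine ⟨_, ⟨g, pNorm_top_le_one_iff.2 (inDualBall_one_iff.1 hg), rfl⟩, ?_⟩
    rw [← sum_mul_mulVec, pNorm_two]
    exact (norm_sum_mul_le _ _).trans (mul_le_of_le_one_left (Real.sqrt_nonneg _)
      (Real.sqrt_le_one.2 (inDualBall_two_iff.1 hf)))
  · rintro Y ⟨f, hf, g, hg, rfl⟩ i j
    rw [Matrix.vecMulVec_apply, norm_mul]
    exact mul_le_one₀ (norm_le_one_of_inDualBall_two f hf i) (norm_nonneg _)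
      (norm_le_one_of_inDualBall_one g hg j)

theorem normF_eq_injNorm (X : Matrix (Fin m) (Fin n) ℂ) : normF X = injNorm 2 1 X :=
  (isPairSup_normF X).unique (isPairSup_injNorm X norm_le_one_of_inDualBall_two
    norm_le_one_of_inDualBall_one)

/-! ### Amplifications over the diagonal -/

/-- With the converse `opNorm_amplify_diagEmb_le`: a matrix over the diagonal algebra is a direct
sum of its coordinate matrices, so being a contraction is a condition on each coordinate. -/
lemma opNorm_coordinate_le {k : ℕ} {U : Matrix (Fin k) (Fin k) (Fin n → ℂ)}
    (hU : opNorm (amplify diagEmb U) ≤ 1) (j : Fin n) :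
    opNorm (Matrix.of fun p q => U p q j) ≤ 1 := by
  refine opNorm_le_of_bilin fun u v hu hv => ?_
  have h := norm_bilin_le hU (a := 1) (b := 1) zero_le_one zero_le_one
    (u := fun p => if p.2 = j then u p.1 else 0) (v := fun q => if q.2 = j then v q.1 else 0)
    (by simpa [Fintype.sum_prod_type, apply_ite] using hu)
    (by simpa [Fintype.sum_prod_type, apply_ite] using hv)
  simpa [Fintype.sum_prod_type, amplify, diagEmb] using h

lemma opNorm_amplify_diagEmb_le {k : ℕ} {U : Matrix (Fin k) (Fin k) (Fin n → ℂ)}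
    (hU : ∀ j, opNorm (Matrix.of fun p q => U p q j) ≤ 1) : opNorm (amplify diagEmb U) ≤ 1 := by
  refine opNorm_le_of_mulVec zero_le_one fun v => ?_
  rw [one_mul]
  refine Real.sqrt_le_sqrt ?_
  rw [Fintype.sum_prod_type_right, Fintype.sum_prod_type_right]
  refine Finset.sum_le_sum fun j _ => ?_
  have := sum_sq_mulVec_le (hU j) fun q => v (q, j)
  simpa [Matrix.mulVec, dotProduct, Fintype.sum_prod_type, amplify, diagEmb,
    Matrix.diagonal_apply] using this

/-- Testing an amplification on `u` and `v` yields the Gram matrix of `x_i = u(·, i)` and `y_j =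
U(j) v`, with `‖y_j‖ ≤ 1` because each coordinate matrix is a contraction. Conversely, Gram vectors
`y_j` are placed in the first column of the coordinate matrices. -/
lemma isPairSup_normCbF (X : Matrix (Fin m) (Fin n) ℂ) :
    IsPairSup (gramUnit m n) X (normCbF X) := by
  refine isPairSup_sSup ⟨_, 0, fun p => p.elim0,
    opNorm_le_of_bilin fun u v _ _ => by simp, rfl⟩ ?_ ?_ ?_
  · rintro _ ⟨k, U, hU, rfl⟩ C hC
    refine opNorm_le_of_bilin fun u v hu hv => ?_
    rw [Fintype.sum_prod_type_right] at hu
    have hv' : ∑ q, ‖v (q, 0)‖ ^ 2 ≤ 1 := by simpa [Fintype.sum_prod_type] using hv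
    have := hC (Matrix.of fun i j => ∑ l, u (l, i) * ∑ q, U l q j * v (q, 0))
      (mem_gramUnit (x := fun i l => u (l, i)) (y := fun j l => ∑ q, U l q j * v (q, 0))
        (fun _ _ => rfl) hu fun j => (sum_sq_mulVec_le (opNorm_coordinate_le hU j) _).trans hv')
    refine le_trans (le_of_eq ?_) this
    congr 1
    simp only [Fintype.sum_prod_type, pair, amplify, Matrix.of_apply, Matrix.replicateCol_apply,
      Matrix.mulVec, dotProduct, Finset.univ_unique, Finset.sum_singleton, Finset.mul_sum,
      Finset.sum_mul, Fin.default_eq_zero]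
    rw [Finset.sum_comm]
    refine Finset.sum_congr rfl fun i _ => ?_
    rw [Finset.sum_congr rfl fun l _ => Finset.sum_comm, Finset.sum_comm]
    exact Finset.sum_congr rfl fun j _ => Finset.sum_congr rfl fun l _ =>
      Finset.sum_congr rfl fun q _ => by ring
  · intro Y hY
    obtain ⟨d, x, y, hxy, hx, hy⟩ := exists_of_mem_gramUnit hY
    rcases d with _ | d
    -- In dimension `0` there is no basis vector `e_0`, but the pairing is zero.
    · refine ⟨_, ⟨0, fun p => p.elim0, opNorm_le_of_bilin fun u v _ _ => by simp, rfl⟩, ?_⟩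
      simpa [pair, hxy] using opNorm_nonneg _
    · refine ⟨_, ⟨d + 1, fun p q j => y j p * (Pi.single 0 1 : Fin (d + 1) → ℂ) q,
        opNorm_amplify_diagEmb_le fun j =>
          opNorm_vecMulVec_le (hy j) (sum_norm_single_sq 0).le, rfl⟩, ?_⟩
      refine le_trans (le_of_eq ?_) (norm_bilin_le_opNorm_of_le_one _
        (u := fun p => x p.2 p.1) (v := fun q => (Pi.single 0 1 : Fin (d + 1) → ℂ) q.1) ?_ ?_)
      · congr 1
        simp only [Fintype.sum_prod_type, pair, amplify, Matrix.of_apply,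
          Matrix.replicateCol_apply, Matrix.mulVec, dotProduct, Finset.univ_unique,
          Finset.sum_singleton, hxy]
        refine Eq.trans (Finset.sum_congr rfl fun i _ => ?_) Finset.sum_comm
        simp only [Finset.mul_sum]
        refine Eq.trans Finset.sum_comm (Finset.sum_congr rfl fun p _ => ?_)
        rw [Finset.sum_eq_single (0 : Fin (d + 1))]
        · simp only [Pi.single_eq_same, mul_one]
          exact Finset.sum_congr rfl fun j _ => by ring
        · intro q _ hq; simp [hq]
        · simp
      · rw [Fintype.sum_prod_type_right]; exact hx
      · rw [Fintype.sum_prod_type]; simpa using (sum_norm_single_sq (0 : Fin (d + 1))).le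
  · exact fun Y hY i j => norm_le_one_of_mem_gramId (gramUnit_subset_gramId hY) i j

/-- As for `normCbF`, with vectors on both sides: `x_i = u U(i)` and `y_j = V(j) v`. Conversely the
`x_i` become first rows and the `y_j` first columns, and the `(0, 0)` entry of the amplification is
the pairing. -/
lemma isPairSup_normCbB (X : Matrix (Fin m) (Fin n) ℂ) :
    IsPairSup (gramId m n) X (normCbB X) := by
  refine isPairSup_sSup ⟨_, 0, fun p => p.elim0, fun p => p.elim0,
    opNorm_le_of_bilin fun u v _ _ => by simp, opNorm_le_of_bilin fun u v _ _ => by simp, rfl⟩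
    ?_ ?_ ?_
  · rintro _ ⟨k, U, V, hU, hV, rfl⟩ C hC
    refine opNorm_le_of_bilin fun u v hu hv => ?_
    have := hC (Matrix.of fun i j => ∑ r, (∑ p, u p * U p r i) * ∑ q, V r q j * v q)
      (mem_gramId (x := fun i r => ∑ p, u p * U p r i) (y := fun j r => ∑ q, V r q j * v q)
        (fun _ _ => rfl)
        (fun i => (sum_sq_vecMul_le (opNorm_coordinate_le hU i) _).trans hu)
        fun j => (sum_sq_mulVec_le (opNorm_coordinate_le hV j) _).trans hv)
    refine le_trans (le_of_eq ?_) this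
    congr 1
    simp only [pair, amplifyBilin, bilinForm, Matrix.of_apply, Finset.sum_mul_sum]
    simp only [Finset.mul_sum, Finset.sum_mul]
    rw [Finset.sum_congr rfl fun p _ => Finset.sum_comm]
    rw [Finset.sum_comm]
    rw [Finset.sum_congr rfl fun r _ => Finset.sum_congr rfl fun p _ => Finset.sum_comm]
    rw [Finset.sum_congr rfl fun r _ => Finset.sum_comm]
    rw [Finset.sum_comm]
    refine Finset.sum_congr rfl fun i _ => ?_
    rw [Finset.sum_congr rfl fun r _ => Finset.sum_congr rfl fun p _ => Finset.sum_comm]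
    rw [Finset.sum_congr rfl fun r _ => Finset.sum_comm]
    rw [Finset.sum_comm]
    exact Finset.sum_congr rfl fun j _ => Finset.sum_congr rfl fun r _ =>
      Finset.sum_congr rfl fun p _ => Finset.sum_congr rfl fun q _ => by ring
  · intro Y hY
    obtain ⟨d, x, y, hxy, hx, hy⟩ := exists_of_mem_gramId hY
    rcases d with _ | d
    · refine ⟨_, ⟨0, fun p => p.elim0, fun p => p.elim0,
        opNorm_le_of_bilin fun u v _ _ => by simp, opNorm_le_of_bilin fun u v _ _ => by simp,
        rfl⟩, ?_⟩
      simpa [pair, hxy] using opNorm_nonneg _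
    · refine ⟨_, ⟨d + 1, fun p r i => (Pi.single 0 1 : Fin (d + 1) → ℂ) p * x i r,
        fun r q j => y j r * (Pi.single 0 1 : Fin (d + 1) → ℂ) q,
        opNorm_amplify_diagEmb_le fun i =>
          opNorm_vecMulVec_le (sum_norm_single_sq 0).le (hx i),
        opNorm_amplify_diagEmb_le fun j =>
          opNorm_vecMulVec_le (hy j) (sum_norm_single_sq 0).le, rfl⟩, ?_⟩
      refine le_trans (le_of_eq ?_) (norm_bilin_le_opNorm_of_le_one _
        (sum_norm_single_sq (0 : Fin (d + 1))).le (sum_norm_single_sq (0 : Fin (d + 1))).le)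
      congr 1
      rw [Finset.sum_eq_single (0 : Fin (d + 1)), Finset.sum_eq_single (0 : Fin (d + 1))]
      · simp only [pair, amplifyBilin, bilinForm, Matrix.of_apply, Pi.single_eq_same, one_mul,
          mul_one, hxy, Finset.mul_sum]
        refine Eq.trans (Eq.trans (Finset.sum_congr rfl fun i _ => Finset.sum_comm)
          Finset.sum_comm) (Finset.sum_congr rfl fun k _ => ?_)
        exact Finset.sum_congr rfl fun i _ => Finset.sum_congr rfl fun j _ => by ring
      · intro q _ hq; simp [hq]
      · simp
      · intro q _ hq; simp [hq]
      · simp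
  · exact fun Y hY i j => norm_le_one_of_mem_gramId hY i j

/-! ### The dual systems of the Schur multiplier norm and of the column sum norm -/

/-- Extracts total masses from the weights of the separating functional. Only `≤ 1` holds in
general, since `s = 0` if all weights vanish. -/
lemma exists_unit_of_nonneg {κ : Type*} [Fintype κ] {p : κ → ℝ} (hp : ∀ i, 0 ≤ p i) :
    ∃ s : κ → ℂ, ∑ i, ‖s i‖ ^ 2 ≤ 1 ∧
      ∀ i, ((√(p i) : ℝ) : ℂ) = ((√(∑ i, p i) : ℝ) : ℂ) * s i := by
  have hP : 0 ≤ ∑ i, p i := Finset.sum_nonneg fun i _ => hp i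
  refine ⟨fun i => ((√(p i) : ℝ) : ℂ) / ((√(∑ i, p i) : ℝ) : ℂ), ?_, fun i => ?_⟩
  · simp only [norm_div, Complex.norm_real, Real.norm_eq_abs, div_pow, sq_abs, Real.sq_sqrt hP,
      Real.sq_sqrt (hp _), ← Finset.sum_div]
    exact div_self_le_one _
  · rcases hP.eq_or_lt with h0 | h0
    · have := (Finset.sum_eq_zero_iff_of_nonneg fun i _ => hp i).1 h0.symm i (Finset.mem_univ i)
      simp [this]
    · have : ((√(∑ i, p i) : ℝ) : ℂ) ≠ 0 := by exact_mod_cast (Real.sqrt_pos.2 h0).ne'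
      field_simp

lemma two_mul_sqrt_mul_le {N z P Q : ℝ} (hN : 0 ≤ N) (hz : z ≤ N) (hP : 0 ≤ P) (hQ : 0 ≤ Q) :
    2 * (√P * √Q * z) ≤ N * (P + Q) := by
  have h1 := Real.sq_sqrt hP
  have h2 := Real.sq_sqrt hQ
  have h3 := Real.sqrt_nonneg P
  have h4 := Real.sqrt_nonneg Q
  have h5 : 2 * (√P * √Q) ≤ P + Q := by nlinarith [sq_nonneg (√P - √Q)]
  have h6 : √P * √Q * z ≤ √P * √Q * N := mul_le_mul_of_nonneg_left hz (mul_nonneg h3 h4)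
  nlinarith

lemma norm_pair_schurSet_le {Y Z : Matrix (Fin m) (Fin n) ℂ} (hZ : Z ∈ gramId m n)
    (hY : Y ∈ schurSet m n) : ‖pair Z Y‖ ≤ 1 := by
  obtain ⟨d, x, y, hxy, hx, hy⟩ := exists_of_mem_gramId hZ
  obtain ⟨A, s, t, hA, hs, ht, hY⟩ := hY
  have h := norm_gram_bilin_le hA (x := x) (y := y) (u := s) (v := t) ?_ ?_
  · convert h using 2
    exact Finset.sum_congr rfl fun i _ => Finset.sum_congr rfl fun j _ => by
      rw [hxy, hY]; ring
  · refine (Finset.sum_le_sum fun i _ => ?_).trans hs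
    simp only [norm_mul, mul_pow, ← Finset.mul_sum]
    exact mul_le_of_le_one_right (by positivity) (hx i)
  · refine (Finset.sum_le_sum fun i _ => ?_).trans ht
    simp only [norm_mul, mul_pow, ← Finset.sum_mul]
    exact mul_le_of_le_one_left (by positivity) (hy i)

/-- With `π = id` both weights `p`, `q` normalize to unit vectors, so the separating matrix is a
multiple of an element of `schurSet`. -/
theorem dualSystem_normS : DualSystem (schurSet m n) (gramId m n) normS normCbB where
  lubN := isPairSup_normS
  lubD := isPairSup_normCbB
  le_one Z hZ := (isPairSup_normS Z).le_of fun _ hY => norm_pair_schurSet_le hZ hY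
  star_mem Z hZ := star_mem_gramSet hZ
  exists_smul X c hc := by
    have hN := (isPairSup_normS X).nonneg
    refine exists_smul_gram id X hN hc fun A p q hA hp hq => ?_
    obtain ⟨s, hs, hps⟩ := exists_unit_of_nonneg hp
    obtain ⟨t, ht, hqt⟩ := exists_unit_of_nonneg hq
    have e : pair X (fun i j => ((√(p (id i)) : ℝ) : ℂ) * A i j * ((√(q j) : ℝ) : ℂ)) =
        (((√(∑ i, p i) : ℝ) : ℂ) * ((√(∑ i, q i) : ℝ) : ℂ)) *
          pair X (fun i j => s i * A i j * t j) := by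
      simp only [pair, Finset.mul_sum, id]
      exact Finset.sum_congr rfl fun i _ => Finset.sum_congr rfl fun j _ => by
        rw [hps, hqt]; ring
    rw [e, norm_mul, norm_mul, Complex.norm_real, Complex.norm_real, Real.norm_eq_abs,
      Real.norm_eq_abs, abs_of_nonneg (Real.sqrt_nonneg _), abs_of_nonneg (Real.sqrt_nonneg _)]
    exact two_mul_sqrt_mul_le hN ((isPairSup_normS X).le ⟨A, s, t, hA, hs, ht, fun _ _ => rfl⟩)
      (Finset.sum_nonneg fun i _ => hp i) (Finset.sum_nonneg fun i _ => hq i)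

lemma norm_pair_columnSet_le {Y Z : Matrix (Fin m) (Fin n) ℂ} (hZ : Z ∈ gramUnit m n)
    (hY : Y ∈ columnSet m n) : ‖pair Z Y‖ ≤ 1 := by
  obtain ⟨d, x, y, hxy, hx, hy⟩ := exists_of_mem_gramUnit hZ
  obtain ⟨A, t, hA, ht, hY⟩ := hY
  have h := norm_gram_bilin_le hA (x := x) (y := y) (u := fun _ => 1) (v := t) ?_ ?_
  · convert h using 2
    exact Finset.sum_congr rfl fun i _ => Finset.sum_congr rfl fun j _ => by
      rw [hxy, hY]; ring
  · simpa using hx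
  · refine (Finset.sum_le_sum fun i _ => ?_).trans ht
    simp only [norm_mul, mul_pow, ← Finset.sum_mul]
    exact mul_le_of_le_one_left (by positivity) (hy i)

/-- With constant `π` the left weight is a single scalar, so only the columns carry weights and the
separating matrix is a multiple of an element of `columnSet`. -/
theorem dualSystem_normT : DualSystem (columnSet m n) (gramUnit m n) normT normCbF where
  lubN := isPairSup_normT
  lubD := isPairSup_normCbF
  le_one Z hZ := (isPairSup_normT Z).le_of fun _ hY => norm_pair_columnSet_le hZ hY
  star_mem Z hZ := star_mem_gramSet hZ
  exists_smul X c hc := by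
    have hN := (isPairSup_normT X).nonneg
    refine exists_smul_gram (fun _ => ()) X hN hc fun A p q hA hp hq => ?_
    obtain ⟨t, ht, hqt⟩ := exists_unit_of_nonneg hq
    have e : pair X (fun i j => ((√(p ()) : ℝ) : ℂ) * A i j * ((√(q j) : ℝ) : ℂ)) =
        (((√(p ()) : ℝ) : ℂ) * ((√(∑ i, q i) : ℝ) : ℂ)) *
          pair X (fun i j => A i j * t j) := by
      simp only [pair, Finset.mul_sum]
      exact Finset.sum_congr rfl fun i _ => Finset.sum_congr rfl fun j _ => by
        rw [hqt]; ring
    rw [e, norm_mul, norm_mul, Complex.norm_real, Complex.norm_real, Real.norm_eq_abs,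
      Real.norm_eq_abs, abs_of_nonneg (Real.sqrt_nonneg _), abs_of_nonneg (Real.sqrt_nonneg _)]
    have hsum : ∑ r, p r = p () := by simp
    rw [hsum]
    exact two_mul_sqrt_mul_le hN ((isPairSup_normT X).le ⟨A, t, hA, ht, fun _ _ => rfl⟩)
      (hp ()) (Finset.sum_nonneg fun i _ => hq i)

/-! ### The completely bounded norms of Schur multipliers and of column sums -/

lemma opNorm_amplify_const_le {A : Matrix (Fin m) (Fin n) ℂ} (hA : opNorm A ≤ 1) :
    opNorm (amplify (fun A : Matrix (Fin m) (Fin n) ℂ => A)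
      (fun _ _ => A : Matrix (Fin 1) (Fin 1) _)) ≤ 1 := by
  refine opNorm_le_of_bilin fun u v hu hv => ?_
  have h := norm_bilin_le hA (a := 1) (b := 1) zero_le_one zero_le_one
    (u := fun i => u (0, i)) (v := fun j => v (0, j))
    (by simpa [Fintype.sum_prod_type] using hu) (by simpa [Fintype.sum_prod_type] using hv)
  simpa [Fintype.sum_prod_type, amplify] using h

/-- An amplified Schur multiplier multiplies by the symbol `X_ij` repeated over all blocks. The Gram
vectors of `X` repeated over the blocks represent it with the same bounds; the converse inequality
is the case of one block. -/
theorem normS_eq_normCbS (X : Matrix (Fin m) (Fin n) ℂ) : normS X = normCbS X := by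
  have hle : ∀ t ∈ {t | ∃ (k : ℕ) (U : Matrix (Fin k) (Fin k) (Matrix (Fin m) (Fin n) ℂ)),
      opNorm (amplify (fun A => A) U) ≤ 1 ∧
        t = opNorm (amplify (fun A => X.hadamard A) U)}, t ≤ normS X := by
    rintro _ ⟨k, U, hU, rfl⟩
    refine le_of_forall_gt_imp_ge_of_dense fun c hc => ?_
    have hc0 := (isPairSup_normS X).nonneg.trans hc.le
    obtain ⟨Z, hZ, rfl⟩ := dualSystem_normS.exists_smul X c hc
    obtain ⟨d, x, y, hxy, hx, hy⟩ := exists_of_mem_gramId hZ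
    refine opNorm_le_of_bilin fun u v hu hv => ?_
    have h := norm_gram_bilin_le hU (x := fun p => x p.2) (y := fun q => y q.2) (u := u) (v := v)
      ?_ ?_
    · have e : ∑ p, ∑ q, u p * amplify (fun A => ((c : ℂ) • Z).hadamard A) U p q * v q =
          c * ∑ p, ∑ q, u p * ((∑ k, x p.2 k * y q.2 k) * amplify (fun A => A) U p q) * v q := by
        simp only [Finset.mul_sum (a := (c : ℂ))]
        exact Finset.sum_congr rfl fun p _ => Finset.sum_congr rfl fun q _ => by
          simp only [amplify, Matrix.of_apply, Matrix.hadamard_apply, Matrix.smul_apply,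
            smul_eq_mul, hxy]
          ring
      rw [e, norm_mul, Complex.norm_real, Real.norm_eq_abs, abs_of_nonneg hc0]
      exact mul_le_of_le_one_right hc0 h
    · refine (Finset.sum_le_sum fun i _ => ?_).trans hu
      simp only [norm_mul, mul_pow, ← Finset.mul_sum]
      exact mul_le_of_le_one_right (by positivity) (hx i.2)
    · refine (Finset.sum_le_sum fun i _ => ?_).trans hv
      simp only [norm_mul, mul_pow, ← Finset.sum_mul]
      exact mul_le_of_le_one_left (by positivity) (hy i.2)
  refine le_antisymm ((isPairSup_normS X).le_of ?_) (csSup_le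
    ⟨_, 0, fun p => p.elim0, opNorm_le_of_bilin fun u v _ _ => by simp, rfl⟩ hle)
  rintro Y ⟨A, s, t, hA, hs, ht, hY⟩
  refine le_trans ?_ (le_csSup ⟨_, hle⟩ ⟨1, fun _ _ => A, opNorm_amplify_const_le hA, rfl⟩)
  refine le_trans (le_of_eq ?_) (norm_bilin_le_opNorm_of_le_one _ (u := fun p => s p.2)
    (v := fun q => t q.2) (by simpa [Fintype.sum_prod_type] using hs)
    (by simpa [Fintype.sum_prod_type] using ht))
  congr 1
  simp only [pair, Fintype.sum_prod_type, amplify, Matrix.of_apply, Matrix.hadamard_apply,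
    Finset.univ_unique, Finset.sum_singleton, hY]
  exact Finset.sum_congr rfl fun i _ => Finset.sum_congr rfl fun j _ => by ring

/-- The same argument with row weights `u_p x_i`: their total mass is at most `∑ ‖u_p‖²`, because
the family `x` has total mass at most `1`. -/
theorem normT_eq_normCbT (X : Matrix (Fin m) (Fin n) ℂ) : normT X = normCbT X := by
  have hle : ∀ t ∈ {t | ∃ (k : ℕ) (U : Matrix (Fin k) (Fin k) (Matrix (Fin m) (Fin n) ℂ)),
      opNorm (amplify (fun A => A) U) ≤ 1 ∧
        t = opNorm (amplify (fun A => Matrix.replicateRow (Fin 1) (columnSums X A)) U)},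
      t ≤ normT X := by
    rintro _ ⟨k, U, hU, rfl⟩
    refine le_of_forall_gt_imp_ge_of_dense fun c hc => ?_
    have hc0 := (isPairSup_normT X).nonneg.trans hc.le
    obtain ⟨Z, hZ, rfl⟩ := dualSystem_normT.exists_smul X c hc
    obtain ⟨d, x, y, hxy, hx, hy⟩ := exists_of_mem_gramUnit hZ
    refine opNorm_le_of_bilin fun u v hu hv => ?_
    have h := norm_gram_bilin_le hU (x := fun p => x p.2) (y := fun q => y q.2)
      (u := fun p => u (p.1, 0)) (v := v) ?_ ?_
    · have e : ∑ p, ∑ q, u p * amplify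
          (fun A => Matrix.replicateRow (Fin 1) (columnSums ((c : ℂ) • Z) A)) U p q * v q =
          c * ∑ p : Fin k × Fin m, ∑ q : Fin k × Fin n, u (p.1, 0) *
            ((∑ k, x p.2 k * y q.2 k) * amplify (fun A => A) U p q) * v q := by
        simp only [Finset.mul_sum (a := (c : ℂ)), Fintype.sum_prod_type (f := fun p : _ × Fin 1 => _),
          Fintype.sum_prod_type (f := fun p : _ × Fin m => _), Finset.univ_unique,
          Finset.sum_singleton, Fin.default_eq_zero]
        refine Finset.sum_congr rfl fun p _ => ?_
        rw [Finset.sum_comm]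
        refine Finset.sum_congr rfl fun q _ => ?_
        simp only [amplify, Matrix.of_apply, Matrix.replicateRow_apply, columnSums,
          Matrix.smul_apply, smul_eq_mul, hxy]
        rw [Finset.mul_sum, Finset.sum_mul]
        exact Finset.sum_congr rfl fun i _ => by ring
      rw [e, norm_mul, Complex.norm_real, Real.norm_eq_abs, abs_of_nonneg hc0]
      exact mul_le_of_le_one_right hc0 h
    · rw [Fintype.sum_prod_type]
      simp only [norm_mul, mul_pow, ← Finset.mul_sum]
      refine (Finset.sum_le_sum fun p _ => mul_le_of_le_one_right (by positivity) hx).trans ?_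
      simpa [Fintype.sum_prod_type] using hu
    · refine (Finset.sum_le_sum fun i _ => ?_).trans hv
      simp only [norm_mul, mul_pow, ← Finset.sum_mul]
      exact mul_le_of_le_one_left (by positivity) (hy i.2)
  refine le_antisymm ((isPairSup_normT X).le_of ?_) (csSup_le
    ⟨_, 0, fun p => p.elim0, opNorm_le_of_bilin fun u v _ _ => by simp, rfl⟩ hle)
  rintro Y ⟨A, t, hA, ht, hY⟩
  refine le_trans ?_ (le_csSup ⟨_, hle⟩ ⟨1, fun _ _ => A, opNorm_amplify_const_le hA, rfl⟩)
  refine le_trans (le_of_eq ?_) (norm_bilin_le_opNorm_of_le_one _ (u := fun _ => 1)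
    (v := fun q => t q.2) (by simp)
    (by simpa [Fintype.sum_prod_type] using ht))
  congr 1
  obtain rfl : Y = fun i j => A i j * t j := by ext i j; exact hY i j
  rw [← sum_mul_columnSums]
  simp [Fintype.sum_prod_type, amplify, mul_comm]

/-! ### Cross norms -/

lemma single_mem_tensorSet {K : Set (Fin m → ℂ)} {L : Set (Fin n → ℂ)}
    (hK : ∀ i, Pi.single i 1 ∈ K) (hL : ∀ j, Pi.single j 1 ∈ L) (i : Fin m) (j : Fin n) :
    Matrix.single i j 1 ∈ tensorSet K L :=
  ⟨_, hK i, _, hL j, single_eq_vecMulVec i j⟩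

lemma norm_pair_tensorSet_le {p r : ℝ≥0∞} [Fact (1 ≤ p)] [Fact (1 ≤ r)] (η : Fin m → ℂ)
    (ξ : Fin n → ℂ) (Y : Matrix (Fin m) (Fin n) ℂ)
    (hY : Y ∈ tensorSet {f | InDualBall p f} {g | InDualBall r g}) :
    ‖pair (Matrix.vecMulVec η ξ) Y‖ ≤ pNorm p η * pNorm r ξ := by
  obtain ⟨f, hf, g, hg, rfl⟩ := hY
  rw [pair_vecMulVec, norm_mul]
  exact mul_le_mul (hf η) (hg ξ) (norm_nonneg _) (pNorm_nonneg _)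

theorem isCrossNorm_normF : IsCrossNorm 2 1 (normF (m := m) (n := n)) :=
  isCrossNorm_of_isPairSup isPairSup_normF
    (single_mem_tensorSet (fun i => inDualBall_two_iff.2 (sum_norm_single_sq i).le)
      fun j => inDualBall_one_iff.2 (norm_single_le_one j))
    (K := {f | InDualBall 2 f}) (L := {g | InDualBall 1 g})
    (fun η => (exists_norming_two η).imp fun _ h => ⟨inDualBall_two_iff.2 h.1, h.2⟩)
    (fun η => (exists_norming_one η).imp fun _ h => ⟨inDualBall_one_iff.2 h.1, h.2⟩)
    (fun f hf g hg => ⟨f, hf, g, hg, rfl⟩) norm_pair_tensorSet_le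

lemma isPairSup_normB (X : Matrix (Fin m) (Fin n) ℂ) :
    IsPairSup (tensorSet {f | InDualBall 1 f} {g | InDualBall 1 g}) X (normB X) := by
  rw [normB_eq_injNorm]
  exact isPairSup_injNorm X norm_le_one_of_inDualBall_one norm_le_one_of_inDualBall_one

theorem isCrossNorm_normB : IsCrossNorm 1 1 (normB (m := m) (n := n)) :=
  isCrossNorm_of_isPairSup isPairSup_normB
    (single_mem_tensorSet (fun i => inDualBall_one_iff.2 (norm_single_le_one i))
      fun j => inDualBall_one_iff.2 (norm_single_le_one j))
    (K := {f | InDualBall 1 f}) (L := {g | InDualBall 1 g})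
    (fun η => (exists_norming_one η).imp fun _ h => ⟨inDualBall_one_iff.2 h.1, h.2⟩)
    (fun η => (exists_norming_one η).imp fun _ h => ⟨inDualBall_one_iff.2 h.1, h.2⟩)
    (fun f hf g hg => ⟨f, hf, g, hg, rfl⟩) norm_pair_tensorSet_le

theorem isCrossNorm_normCbF : IsCrossNorm 2 1 (normCbF (m := m) (n := n)) :=
  isCrossNorm_of_isPairSup isPairSup_normCbF
    (fun i j => by
      rw [single_eq_vecMulVec]
      exact vecMulVec_mem_gramUnit (sum_norm_single_sq i).le (norm_single_le_one j))
    (K := {f | ∑ i, ‖f i‖ ^ 2 ≤ 1}) (L := {g | ∀ j, ‖g j‖ ≤ 1})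
    exists_norming_two exists_norming_one
    (fun f hf g hg => vecMulVec_mem_gramUnit hf hg)
    (by
      intro η ξ Z hZ
      obtain ⟨d, x, y, hxy, hx, hy⟩ := exists_of_mem_gramUnit hZ
      -- A bound independent of `j` lets `ξ` be summed in the `1`-norm, while `η` meets the `ℓ²`
      -- family of the `‖x_i‖` by Cauchy–Schwarz.
      have hent : ∀ i j, ‖Z i j‖ ≤ √(∑ k, ‖x i k‖ ^ 2) := by
        intro i j
        rw [hxy]
        exact (norm_sum_mul_le _ _).trans
          (mul_le_of_le_one_right (Real.sqrt_nonneg _) (Real.sqrt_le_one.2 (hy j)))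
      calc _ ≤ ∑ i, ∑ j, ‖η i‖ * ‖ξ j‖ * √(∑ k, ‖x i k‖ ^ 2) := by
            refine (norm_sum_le _ _).trans (Finset.sum_le_sum fun i _ => (norm_sum_le _ _).trans
              (Finset.sum_le_sum fun j _ => ?_))
            rw [Matrix.vecMulVec_apply, norm_mul, norm_mul]
            exact mul_le_mul_of_nonneg_left (hent i j) (by positivity)
        _ = (∑ i, ‖η i‖ * √(∑ k, ‖x i k‖ ^ 2)) * ∑ j, ‖ξ j‖ := by
            rw [Finset.sum_mul_sum]
            exact Finset.sum_congr rfl fun i _ => Finset.sum_congr rfl fun j _ => by ring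
        _ ≤ _ := by
            rw [pNorm_one, pNorm_two]
            refine mul_le_mul_of_nonneg_right ?_ (by positivity)
            refine (Real.sum_mul_le_sqrt_mul_sqrt _ _ _).trans
              (mul_le_of_le_one_right (Real.sqrt_nonneg _) (Real.sqrt_le_one.2 ?_))
            simpa only [Real.sq_sqrt (show 0 ≤ ∑ k, ‖x _ k‖ ^ 2 by positivity)] using hx)

theorem isCrossNorm_normCbB : IsCrossNorm 1 1 (normCbB (m := m) (n := n)) :=
  isCrossNorm_of_isPairSup isPairSup_normCbB
    (fun i j => by
      rw [single_eq_vecMulVec]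
      exact vecMulVec_mem_gramId (norm_single_le_one i) (norm_single_le_one j))
    (K := {f | ∀ i, ‖f i‖ ≤ 1}) (L := {g | ∀ j, ‖g j‖ ≤ 1})
    exists_norming_one exists_norming_one
    (fun f hf g hg => vecMulVec_mem_gramId hf hg)
    (by
      intro η ξ Z hZ
      refine (norm_pair_le_sum _ (norm_le_one_of_mem_gramId hZ)).trans (le_of_eq ?_)
      rw [pNorm_one, pNorm_one, Finset.sum_mul_sum]
      exact Finset.sum_congr rfl fun i _ => Finset.sum_congr rfl fun j _ => by
        rw [Matrix.vecMulVec_apply, norm_mul])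

lemma vecMulVec_zero_right (f : Fin m → ℂ) :
    Matrix.vecMulVec f (0 : Fin n → ℂ) = 0 := by
  ext i j; simp [Matrix.vecMulVec_apply]

lemma zero_mem_schurSet : (0 : Matrix (Fin m) (Fin n) ℂ) ∈ schurSet m n :=
  ⟨0, 0, 0, opNorm_zero_le, by simp, by simp, by simp⟩

lemma zero_mem_columnSet : (0 : Matrix (Fin m) (Fin n) ℂ) ∈ columnSet m n :=
  ⟨0, 0, opNorm_zero_le, by simp, by simp⟩

lemma vecMulVec_single_mem_columnSet {f : Fin m → ℂ} (hf : ∑ i, ‖f i‖ ^ 2 ≤ 1) (j : Fin n) :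
    Matrix.vecMulVec f (Pi.single j 1) ∈ columnSet m n :=
  ⟨Matrix.vecMulVec f (Pi.single j 1), Pi.single j 1,
    opNorm_vecMulVec_le hf (sum_norm_single_sq j).le, (sum_norm_single_sq j).le, fun i' j' => by
      by_cases h : j' = j <;> simp [Matrix.vecMulVec_apply, h]⟩

lemma single_mem_schurSet (i : Fin m) (j : Fin n) :
    Matrix.vecMulVec (Pi.single i 1) (Pi.single j 1) ∈ schurSet m n :=
  ⟨Matrix.vecMulVec (Pi.single i 1) (Pi.single j 1), Pi.single i 1, Pi.single j 1,
    opNorm_vecMulVec_le (sum_norm_single_sq i).le (sum_norm_single_sq j).le,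
    (sum_norm_single_sq i).le, (sum_norm_single_sq j).le, fun i' j' => by
      by_cases h : j' = j <;> by_cases h' : i' = i <;> simp [Matrix.vecMulVec_apply, h, h']⟩

lemma sum_sq_mul_le {k : ℕ} {s ξ : Fin k → ℂ} (hs : ∑ i, ‖s i‖ ^ 2 ≤ 1) :
    ∑ i, ‖ξ i * s i‖ ^ 2 ≤ pNorm ∞ ξ ^ 2 := by
  calc _ ≤ ∑ i, pNorm ∞ ξ ^ 2 * ‖s i‖ ^ 2 := Finset.sum_le_sum fun i _ => by
        rw [norm_mul, mul_pow]
        exact mul_le_mul_of_nonneg_right (pow_le_pow_left₀ (norm_nonneg _) (le_pNorm_top ξ i) 2)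
          (by positivity)
    _ ≤ _ := by
        rw [← Finset.mul_sum]
        exact mul_le_of_le_one_right (by positivity) hs

theorem isCrossNorm_normS : IsCrossNorm ∞ ∞ (normS (m := m) (n := n)) :=
  isCrossNorm_of_isPairSup isPairSup_normS
    (fun i j => by
      rw [single_eq_vecMulVec]
      exact single_mem_schurSet i j)
    (K := {f | f = 0 ∨ ∃ i, f = Pi.single i 1}) (L := {f | f = 0 ∨ ∃ i, f = Pi.single i 1})
    exists_norming_top exists_norming_top
    (by
      rintro f (rfl | ⟨i, rfl⟩) g (rfl | ⟨j, rfl⟩)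
      · rw [Matrix.zero_vecMulVec]; exact zero_mem_schurSet
      · rw [Matrix.zero_vecMulVec]; exact zero_mem_schurSet
      · rw [vecMulVec_zero_right]; exact zero_mem_schurSet
      · exact single_mem_schurSet i j)
    (by
      rintro η ξ Y ⟨A, s, t, hA, hs, ht, hY⟩
      -- The factors `η`, `ξ` are absorbed into the unit vectors `s`, `t`, whose norms grow at most
      -- by the sup norms.
      refine le_trans (le_of_eq ?_) (norm_bilin_le hA (pNorm_nonneg η) (pNorm_nonneg ξ)
        (sum_sq_mul_le hs) (sum_sq_mul_le ht))
      congr 1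
      exact Finset.sum_congr rfl fun i _ => Finset.sum_congr rfl fun j _ => by
        rw [Matrix.vecMulVec_apply, hY]; ring)

theorem isCrossNorm_normT : IsCrossNorm 2 ∞ (normT (m := m) (n := n)) :=
  isCrossNorm_of_isPairSup isPairSup_normT
    (fun i j => by
      rw [single_eq_vecMulVec]
      exact vecMulVec_single_mem_columnSet (sum_norm_single_sq i).le j)
    (K := {f | ∑ i, ‖f i‖ ^ 2 ≤ 1}) (L := {f | f = 0 ∨ ∃ i, f = Pi.single i 1})
    exists_norming_two exists_norming_top
    (by
      rintro f hf g (rfl | ⟨j, rfl⟩)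
      · rw [vecMulVec_zero_right]; exact zero_mem_columnSet
      · exact vecMulVec_single_mem_columnSet hf j)
    (by
      rintro η ξ Y ⟨A, t, hA, ht, hY⟩
      refine le_trans (le_of_eq ?_) (norm_bilin_le hA (pNorm_nonneg η) (pNorm_nonneg ξ)
        (pNorm_two_sq η).ge (sum_sq_mul_le ht))
      congr 1
      exact Finset.sum_congr rfl fun i _ => Finset.sum_congr rfl fun j _ => by
        rw [Matrix.vecMulVec_apply, hY]; ring)

/-! ### Grothendieck's inequality -/

/-- The Rademacher sum `∑ k, ± x_k`. -/
def rademacher {d : ℕ} (x : Fin d → ℂ) (ω : Fin d → Bool) : ℂ :=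
  ∑ k, (if ω k then 1 else -1) * x k

lemma sum_bool_fun_succ {M : Type*} [AddCommMonoid M] {d : ℕ} (f : (Fin (d + 1) → Bool) → M) :
    ∑ ω, f ω = ∑ ω : Fin d → Bool, (f (Fin.cons true ω) + f (Fin.cons false ω)) := by
  rw [← (Fin.consEquiv fun _ : Fin (d + 1) => Bool).sum_comp, Fintype.sum_prod_type,
    Fintype.sum_bool, ← Finset.sum_add_distrib]
  rfl

lemma rademacher_cons_true {d : ℕ} (x : Fin (d + 1) → ℂ) (ω : Fin d → Bool) :
    rademacher x (Fin.cons true ω) = x 0 + rademacher (Fin.tail x) ω := by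
  simp [rademacher, Fin.sum_univ_succ, Fin.tail]

lemma rademacher_cons_false {d : ℕ} (x : Fin (d + 1) → ℂ) (ω : Fin d → Bool) :
    rademacher x (Fin.cons false ω) = -x 0 + rademacher (Fin.tail x) ω := by
  simp [rademacher, Fin.sum_univ_succ, Fin.tail]

lemma sum_rademacher_mul {d : ℕ} (x y : Fin d → ℂ) :
    ∑ ω, rademacher x ω * rademacher y ω = 2 ^ d * ∑ k, x k * y k := by
  induction d with
  | zero => simp [rademacher]
  | succ d ih =>
    rw [sum_bool_fun_succ, Fin.sum_univ_succ]
    simp only [rademacher_cons_true, rademacher_cons_false]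
    have : ∀ ω, (x 0 + rademacher (Fin.tail x) ω) * (y 0 + rademacher (Fin.tail y) ω) +
        (-x 0 + rademacher (Fin.tail x) ω) * (-y 0 + rademacher (Fin.tail y) ω) =
        2 * (x 0 * y 0) + 2 * (rademacher (Fin.tail x) ω * rademacher (Fin.tail y) ω) :=
      fun ω => by ring
    simp only [this, Finset.sum_add_distrib, ← Finset.mul_sum, ih]
    simp only [Finset.sum_const, Finset.card_univ, Fintype.card_pi, Fintype.card_bool,
      Finset.prod_const, Fintype.card_fin, nsmul_eq_mul, Fin.tail]
    push_cast
    ring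

lemma star_rademacher {d : ℕ} (x : Fin d → ℂ) (ω : Fin d → Bool) :
    rademacher (star x) ω = star (rademacher x ω) := by
  simp [rademacher, apply_ite]

lemma sum_rademacher_sq {d : ℕ} (x : Fin d → ℂ) :
    ∑ ω, ‖rademacher x ω‖ ^ 2 = 2 ^ d * ∑ k, ‖x k‖ ^ 2 := by
  have h := sum_rademacher_mul x (star x)
  simp only [star_rademacher, Complex.star_def, Pi.star_apply, Complex.mul_conj'] at h
  exact_mod_cast h

/-- The two sides differ by a multiple of `|a|²|b|² - Re(a b̄)² = Im(a b̄)²`, the square given to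
`nlinarith`. -/
lemma norm_pow_four_add_le (a b : ℂ) :
    ‖a + b‖ ^ 4 + ‖-a + b‖ ^ 4 ≤ 2 * (‖a‖ ^ 4 + 6 * (‖a‖ ^ 2 * ‖b‖ ^ 2) + ‖b‖ ^ 4) := by
  have e : ∀ z : ℂ, ‖z‖ ^ 4 = (z.re ^ 2 + z.im ^ 2) ^ 2 := fun z => by
    rw [show 4 = 2 * 2 from rfl, pow_mul, Complex.sq_norm, Complex.normSq_apply]; ring
  have e' : ∀ z : ℂ, ‖z‖ ^ 2 = z.re ^ 2 + z.im ^ 2 := fun z => by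
    rw [Complex.sq_norm, Complex.normSq_apply]; ring
  simp only [e, e', Complex.add_re, Complex.add_im, Complex.neg_re, Complex.neg_im]
  nlinarith [sq_nonneg (a.re * b.im - a.im * b.re)]

/-- Khinchin's inequality for the fourth moment, by induction on the number of signs. With `t` the
mass of the tail, averaging over the first sign gives `|x₀|⁴ + 6|x₀|² t + 3t² ≤ 3(|x₀|² + t)²`. -/
lemma sum_rademacher_pow_four_le {d : ℕ} (x : Fin d → ℂ) :
    ∑ ω, ‖rademacher x ω‖ ^ 4 ≤ 3 * 2 ^ d * (∑ k, ‖x k‖ ^ 2) ^ 2 := by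
  induction d with
  | zero => simp [rademacher]
  | succ d ih =>
    rw [sum_bool_fun_succ, Fin.sum_univ_succ]
    simp only [rademacher_cons_true, rademacher_cons_false]
    refine (Finset.sum_le_sum fun ω _ => norm_pow_four_add_le _ _).trans ?_
    simp only [← Finset.mul_sum, Finset.sum_add_distrib, sum_rademacher_sq]
    have h := ih (Fin.tail x)
    set t := ∑ k, ‖Fin.tail x k‖ ^ 2 with ht
    have ht' : ∑ i : Fin d, ‖x i.succ‖ ^ 2 = t := rfl
    rw [ht']
    have hcard : ∑ _ω : Fin d → Bool, ‖x 0‖ ^ 4 = 2 ^ d * ‖x 0‖ ^ 4 := by simp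
    rw [hcard]
    have h2 : (0 : ℝ) ≤ 2 ^ d * ‖x 0‖ ^ 4 := by positivity
    calc _ ≤ 2 * (2 ^ d * ‖x 0‖ ^ 4 + 6 * (‖x 0‖ ^ 2 * (2 ^ d * t)) + 3 * 2 ^ d * t ^ 2) := by
          gcongr
      _ ≤ _ := by rw [pow_succ (2 : ℝ) d]; nlinarith

/-- The truncation of a complex number at modulus `8`. -/
def trunc (z : ℂ) : ℂ := if ‖z‖ ≤ 8 then z else 0

lemma norm_trunc_le (z : ℂ) : ‖trunc z‖ ≤ 8 := by
  unfold trunc; split_ifs with h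
  · exact h
  · simp

lemma norm_trunc_le_norm (z : ℂ) : ‖trunc z‖ ≤ ‖z‖ := by
  unfold trunc; split_ifs with h
  · exact le_rfl
  · simp

lemma norm_sub_trunc_sq_le (z : ℂ) : ‖z - trunc z‖ ^ 2 ≤ ‖z‖ ^ 4 / 64 := by
  unfold trunc; split_ifs with h
  · simp; positivity
  · push Not at h
    rw [sub_zero]
    nlinarith [sq_nonneg (‖z‖), mul_nonneg (sq_nonneg ‖z‖) (sub_nonneg.2 h.le)]

/-- Realize `⟨x_i, y_j⟩` as the average of `f_i g_j` for Rademacher sums, and split `f g = trunc f ·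
trunc g + trunc f · (g - trunc g) + (f - trunc f) · g`. The first term is an average of rank one
matrices with factors bounded by `8`, contributing `64 * normB X`. Each of the others is a quarter
of a Gram matrix, hence contributes at most `normCbB X / 4`, and these are absorbed on the left. -/
theorem normCbB_le_mul_normB (X : Matrix (Fin m) (Fin n) ℂ) : normCbB X ≤ 128 * normB X := by
  suffices h : normCbB X ≤ 64 * normB X + normCbB X / 2 by linarith
  refine (isPairSup_normCbB X).le_of fun Z hZ => ?_
  obtain ⟨d, x, y, hxy, hx, hy⟩ := exists_of_mem_gramId hZ
  -- Normalizes counting measure on the signs to a probability measure, one factor `s` for each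
  -- function.
  set s : ℝ := (√(2 ^ d))⁻¹ with hs
  have hs2 : s ^ 2 = (2 ^ d)⁻¹ := by rw [hs, inv_pow, Real.sq_sqrt (by positivity)]
  have hsc : (s : ℂ) * s = (2 ^ d)⁻¹ := by
    rw [← Complex.ofReal_mul, ← sq, hs2]; push_cast; rfl
  set f := fun i => rademacher (x i) with hf
  set g := fun j => rademacher (y j) with hg
  have h2d : (0 : ℝ) < 2 ^ d := by positivity
  have hf2 : ∀ i, ∑ ω, ‖(s : ℂ) * f i ω‖ ^ 2 ≤ 1 := by
    intro i
    simp only [norm_mul, mul_pow, ← Finset.mul_sum, Complex.norm_real, Real.norm_eq_abs, sq_abs,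
      hs2, hf, sum_rademacher_sq]
    rw [inv_mul_cancel_left₀ h2d.ne']; exact hx i
  have hg2 : ∀ j, ∑ ω, ‖(s : ℂ) * g j ω‖ ^ 2 ≤ 1 := by
    intro j
    simp only [norm_mul, mul_pow, ← Finset.mul_sum, Complex.norm_real, Real.norm_eq_abs, sq_abs,
      hs2, hg, sum_rademacher_sq]
    rw [inv_mul_cancel_left₀ h2d.ne']; exact hy j
  -- The choice of level `8`: the mean square of the tail is at most `3/64`, so even four times the
  -- tail has mean square at most `3/4`.
  have htail : ∀ w : Fin d → ℂ, ∑ k, ‖w k‖ ^ 2 ≤ 1 →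
      ∑ ω, ‖(4 * s : ℂ) * (rademacher w ω - trunc (rademacher w ω))‖ ^ 2 ≤ 1 := by
    intro w hw
    have h4 : ‖(4 * s : ℂ)‖ ^ 2 = 16 * (2 ^ d)⁻¹ := by
      rw [norm_mul, mul_pow, Complex.norm_real, Real.norm_eq_abs, sq_abs, hs2]; norm_num
    simp only [norm_mul _ (rademacher w _ - _), mul_pow, ← Finset.mul_sum, h4]
    have h5 : ∑ ω, ‖rademacher w ω - trunc (rademacher w ω)‖ ^ 2 ≤ 3 * 2 ^ d / 64 := by
      refine (Finset.sum_le_sum fun ω _ => norm_sub_trunc_sq_le _).trans ?_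
      rw [← Finset.sum_div]
      refine div_le_div_of_nonneg_right ((sum_rademacher_pow_four_le w).trans ?_) (by norm_num)
      exact mul_le_of_le_one_right (by positivity) (pow_le_one₀ (by positivity) hw)
    calc _ ≤ (16 : ℝ) * (2 ^ d)⁻¹ * (3 * 2 ^ d / 64) := by gcongr
      _ = 3 / 4 := by field_simp; norm_num
      _ ≤ 1 := by norm_num
  have htrunc : ∀ (i : Fin m), ∑ ω, ‖(s : ℂ) * trunc (f i ω)‖ ^ 2 ≤ 1 := by
    intro i
    refine (Finset.sum_le_sum fun ω _ => ?_).trans (hf2 i)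
    rw [norm_mul, norm_mul]
    gcongr
    exact norm_trunc_le_norm _
  set Z₁ : Matrix (Fin m) (Fin n) ℂ := Matrix.of fun i j =>
    ∑ ω, (s : ℂ) * trunc (f i ω) * (4 * s * (g j ω - trunc (g j ω))) with hZ₁
  set Z₂ : Matrix (Fin m) (Fin n) ℂ := Matrix.of fun i j =>
    ∑ ω, (4 * s * (f i ω - trunc (f i ω))) * ((s : ℂ) * g j ω) with hZ₂
  have h1 : ‖pair X Z₁‖ ≤ normCbB X := (isPairSup_normCbB X).le
    (mem_gramId (fun _ _ => rfl) htrunc fun j => htail (y j) (hy j))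
  have h2 : ‖pair X Z₂‖ ≤ normCbB X := (isPairSup_normCbB X).le
    (mem_gramId (fun _ _ => rfl) (fun i => htail (x i) (hx i)) hg2)
  set T : (Fin d → Bool) → Matrix (Fin m) (Fin n) ℂ := fun ω =>
    Matrix.vecMulVec (fun i => trunc (f i ω) / 8) (fun j => trunc (g j ω) / 8) with hT
  have h8 : ∀ z, ‖trunc z / 8‖ ≤ 1 := fun z => by
    rw [norm_div]
    have := norm_trunc_le z
    norm_num
    linarith
  have h3 : ∀ ω, ‖pair X (T ω)‖ ≤ normB X := fun ω => (isPairSup_normB X).le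
    ⟨_, inDualBall_one_iff.2 fun i => h8 _, _, inDualBall_one_iff.2 fun j => h8 _, rfl⟩
  have hdecomp : pair X Z = (64 * (2 ^ d)⁻¹ : ℂ) * ∑ ω, pair X (T ω) + (1 / 4) * pair X Z₁ +
      (1 / 4) * pair X Z₂ := by
    have hent : ∀ i j, Z i j = (64 * (2 ^ d)⁻¹ : ℂ) * ∑ ω, T ω i j + (1 / 4) * Z₁ i j +
        (1 / 4) * Z₂ i j := by
      intro i j
      have h0 : Z i j = ((2 : ℂ) ^ d)⁻¹ * ∑ ω, f i ω * g j ω := by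
        simp only [hf, hg]
        rw [hxy, sum_rademacher_mul, inv_mul_cancel_left₀ (pow_ne_zero _ two_ne_zero)]
      simp only [h0, hZ₁, hZ₂, hT, Matrix.of_apply, Matrix.vecMulVec_apply, ← hsc,
        Finset.mul_sum, ← Finset.sum_add_distrib]
      exact Finset.sum_congr rfl fun ω _ => by ring
    simp only [pair, hent, mul_add, Finset.sum_add_distrib, Finset.mul_sum]
    congr 1
    · congr 1
      · refine Eq.trans (Finset.sum_congr rfl fun i _ => Finset.sum_comm) ?_
        rw [Finset.sum_comm]
        exact Finset.sum_congr rfl fun ω _ => Finset.sum_congr rfl fun i _ =>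
          Finset.sum_congr rfl fun j _ => by ring
      · exact Finset.sum_congr rfl fun i _ => Finset.sum_congr rfl fun j _ => by ring
    · exact Finset.sum_congr rfl fun i _ => Finset.sum_congr rfl fun j _ => by ring
  have h4 : ‖(64 * (2 ^ d)⁻¹ : ℂ) * ∑ ω, pair X (T ω)‖ ≤ 64 * normB X := by
    rw [norm_mul]
    have h5 : ‖∑ ω, pair X (T ω)‖ ≤ 2 ^ d * normB X := by
      refine (norm_sum_le _ _).trans ((Finset.sum_le_sum fun ω _ => h3 ω).trans (le_of_eq ?_))
      simp
    have h6 : ‖(64 * (2 ^ d)⁻¹ : ℂ)‖ = 64 * (2 ^ d)⁻¹ := by simp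
    rw [h6]
    calc _ ≤ 64 * (2 ^ d)⁻¹ * (2 ^ d * normB X) := by gcongr
      _ = _ := by field_simp
  rw [hdecomp]
  refine (norm_add₃_le).trans ?_
  have e4 : ∀ z : ℂ, ‖(1 / 4 : ℂ) * z‖ = ‖z‖ / 4 := fun z => by
    rw [norm_mul]; norm_num; ring
  rw [e4, e4]
  linarith

/-! ### The best constants in the big and the little inequality -/

/-- The infimum of the admissible constants is itself admissible. Nonemptiness is essential, as
`sInf ∅ = 0`. -/
lemma le_sInf_mul {S : Set ℝ} (hS : S.Nonempty) {v b : ℝ} (hb : 0 ≤ b)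
    (h : ∀ K ∈ S, v ≤ K * b) : v ≤ sInf S * b := by
  rcases hb.eq_or_lt with h0 | h0
  · obtain ⟨K, hK⟩ := hS
    have := h K hK
    rw [← h0, mul_zero] at this ⊢
    exact this
  · rw [← div_le_iff₀ h0]
    exact le_csInf hS fun K hK => (div_le_iff₀ h0).2 (h K hK)

lemma pair_inner_mem_gramId {d : ℕ} {x : Fin m → EuclideanSpace ℂ (Fin d)}
    {y : Fin n → EuclideanSpace ℂ (Fin d)} (hx : ∀ i, ‖x i‖ ≤ 1) (hy : ∀ j, ‖y j‖ ≤ 1) :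
    (Matrix.of fun i j => inner ℂ (x i) (y j)) ∈ gramId m n := by
  refine mem_gramId (x := fun i k => star (x i k)) (y := fun j k => y j k) (fun i j => ?_)
    (fun i => ?_) fun j => ?_
  · simp [PiLp.inner_apply, mul_comm]
  · have := hx i
    rw [EuclideanSpace.norm_eq, Real.sqrt_le_one] at this
    simpa using this
  · have := hy j
    rwa [EuclideanSpace.norm_eq, Real.sqrt_le_one] at this

lemma exists_inner_of_mem_gramId {Z : Matrix (Fin m) (Fin n) ℂ} (hZ : Z ∈ gramId m n) :
    ∃ (d : ℕ) (x : Fin m → EuclideanSpace ℂ (Fin d)) (y : Fin n → EuclideanSpace ℂ (Fin d)),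
      (∀ i j, Z i j = inner ℂ (x i) (y j)) ∧ (∀ i, ‖x i‖ ≤ 1) ∧ ∀ j, ‖y j‖ ≤ 1 := by
  obtain ⟨d, x, y, hxy, hx, hy⟩ := exists_of_mem_gramId hZ
  refine ⟨d, fun i => WithLp.toLp 2 fun k => star (x i k), fun j => WithLp.toLp 2 (y j),
    fun i j => ?_, fun i => ?_, fun j => ?_⟩
  · simp [PiLp.inner_apply, hxy, mul_comm]
  · rw [EuclideanSpace.norm_eq, Real.sqrt_le_one]; simpa using hx i
  · rw [EuclideanSpace.norm_eq, Real.sqrt_le_one]; simpa using hy j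

theorem normCbB_le_bigConst (X : Matrix (Fin m) (Fin n) ℂ) :
    normCbB X ≤ bigConst * normB X := by
  refine (isPairSup_normCbB X).le_of fun Z hZ => ?_
  unfold bigConst
  refine le_sInf_mul ?_ (isPairSup_normB X).nonneg fun K hK => ?_
  · refine ⟨128, by norm_num, fun m n d X x y hx hy => ?_⟩
    exact ((isPairSup_normCbB X).le (pair_inner_mem_gramId hx hy)).trans (normCbB_le_mul_normB X)
  · obtain ⟨d, x, y, hxy, hx, hy⟩ := exists_inner_of_mem_gramId hZ
    have := hK.2 m n d X x y hx hy
    simpa only [pair, hxy] using this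

lemma pNorm_mulVec_le_normF (X : Matrix (Fin m) (Fin n) ℂ) {z : Fin n → ℂ}
    (hz : ∀ j, ‖z j‖ ≤ 1) : pNorm 2 (X *ᵥ z) ≤ normF X := by
  rw [pNorm_two]
  refine sum_sq_le_one_of_pairing (isPairSup_normF X).nonneg fun u hu => ?_
  rw [sum_mul_mulVec]
  exact (isPairSup_normF X).le ⟨u, inDualBall_two_iff.2 hu, z, inDualBall_one_iff.2 hz, rfl⟩

lemma normB_gram_le (X : Matrix (Fin m) (Fin n) ℂ) : normB (Xᴴ * X) ≤ normF X ^ 2 := by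
  refine (isPairSup_normB _).le_of ?_
  rintro Y ⟨f, hf, g, hg, rfl⟩
  rw [Set.mem_ofPred_eq, inDualBall_one_iff] at hf hg
  have e : pair (Xᴴ * X) (Matrix.vecMulVec f g) =
      ∑ i, star ((X *ᵥ star f) i) * (X *ᵥ g) i := by
    rw [← sum_mul_mulVec, ← Matrix.mulVec_mulVec]
    change f ⬝ᵥ Xᴴ *ᵥ (X *ᵥ g) = star (X *ᵥ star f) ⬝ᵥ (X *ᵥ g)
    rw [Matrix.star_mulVec, star_star, Matrix.dotProduct_mulVec]
  rw [e, sq]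
  refine (norm_sum_mul_le _ _).trans ?_
  simp only [norm_star]
  rw [← pNorm_two, ← pNorm_two]
  exact mul_le_mul (pNorm_mulVec_le_normF X (by simpa using hf)) (pNorm_mulVec_le_normF X hg)
    (pNorm_nonneg _) (isPairSup_normF X).nonneg

/-- The left side is the pairing of `Xᴴ * X` with the Gram matrix of the vectors `(a_l(j))_l`, so
the little inequality follows from the big one and `normB (Xᴴ * X) ≤ normF X ^ 2`. -/
lemma sum_pNorm_mulVec_sq_le {d : ℕ} (X : Matrix (Fin m) (Fin n) ℂ) (a : Fin d → Fin n → ℂ)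
    (ha : ∀ j, ∑ l, ‖a l j‖ ^ 2 ≤ 1) : ∑ l, pNorm 2 (X *ᵥ a l) ^ 2 ≤ 128 * normF X ^ 2 := by
  have hZ : (Matrix.of fun j k => ∑ l, star (a l j) * a l k) ∈ gramId n n :=
    mem_gramId (x := fun j l => star (a l j)) (y := fun k l => a l k) (fun _ _ => rfl)
      (by simpa using ha) ha
  have h := ((isPairSup_normCbB (Xᴴ * X)).le hZ).trans ((normCbB_le_mul_normB _).trans
    (mul_le_mul_of_nonneg_left (normB_gram_le X) (by norm_num)))
  have e : pair (Xᴴ * X) (Matrix.of fun j k => ∑ l, star (a l j) * a l k) =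
      ((∑ l, pNorm 2 (X *ᵥ a l) ^ 2 : ℝ) : ℂ) := by
    have e1 : ∀ l, ((pNorm 2 (X *ᵥ a l) ^ 2 : ℝ) : ℂ) =
        pair (Xᴴ * X) (Matrix.vecMulVec (star (a l)) (a l)) := by
      intro l
      rw [← sum_mul_mulVec, ← Matrix.mulVec_mulVec, pNorm_two_sq]
      change _ = star (a l) ⬝ᵥ Xᴴ *ᵥ (X *ᵥ a l)
      rw [Matrix.dotProduct_mulVec, ← Matrix.star_mulVec]
      simp [dotProduct, Complex.conj_mul']
    rw [Complex.ofReal_sum, Finset.sum_congr rfl fun l _ => e1 l]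
    simp only [pair, Matrix.of_apply, Finset.mul_sum, Matrix.vecMulVec_apply, Pi.star_apply]
    refine Eq.trans (Finset.sum_congr rfl fun i _ => Finset.sum_comm) ?_
    rw [Finset.sum_comm]
  rw [e, Complex.norm_real] at h
  exact (le_abs_self _).trans h

lemma littleConst_nonneg : 0 ≤ littleConst := Real.sInf_nonneg fun _ hK => hK.1

/-- For a Gram matrix with coordinates `x(k)`, `y(k)` the pairing is `∑_k x(k) · X y(k)`.
Cauchy–Schwarz removes `x`, and the little inequality applies to the vectors `y(k)`. -/
theorem normCbF_le_littleConst (X : Matrix (Fin m) (Fin n) ℂ) :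
    normCbF X ≤ √littleConst * normF X := by
  refine (isPairSup_normCbF X).le_of fun Z hZ => ?_
  obtain ⟨d, x, y, hxy, hx, hy⟩ := exists_of_mem_gramUnit hZ
  have h1 : ∑ k, pNorm 2 (X *ᵥ fun j => y j k) ^ 2 ≤ littleConst * normF X ^ 2 := by
    unfold littleConst
    refine le_sInf_mul ?_ (sq_nonneg _) fun K hK => hK.2 m n d X (fun k j => y j k) hy
    exact ⟨128, by norm_num, fun _ _ _ X a ha => sum_pNorm_mulVec_sq_le X a ha⟩
  have e : pair X Z = ∑ p : Fin m × Fin d, x p.1 p.2 * (X *ᵥ fun j => y j p.2) p.1 := by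
    simp only [pair, hxy, Fintype.sum_prod_type, Matrix.mulVec, dotProduct, Finset.mul_sum]
    refine Finset.sum_congr rfl fun i _ => ?_
    rw [Finset.sum_comm]
    exact Finset.sum_congr rfl fun k _ => Finset.sum_congr rfl fun j _ => by ring
  rw [e, ← Real.sqrt_sq (isPairSup_normF X).nonneg, ← Real.sqrt_mul littleConst_nonneg]
  refine (norm_sum_mul_le _ _).trans ?_
  refine (mul_le_of_le_one_left (Real.sqrt_nonneg _) (Real.sqrt_le_one.2 ?_)).trans
    (Real.sqrt_le_sqrt (le_trans (le_of_eq ?_) h1))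
  · simpa only [Fintype.sum_prod_type] using hx
  · rw [Fintype.sum_prod_type, Finset.sum_comm]
    simp only [pNorm_two_sq]

/-! ### The projective cross norm -/

section Proj

variable {p r : ℝ≥0∞} [Fact (1 ≤ p)] [Fact (1 ≤ r)]

lemma pNorm_smul {k : ℕ} (c : ℂ) (v : Fin k → ℂ) : pNorm p (c • v) = ‖c‖ * pNorm p v := by
  rw [pNorm, WithLp.toLp_smul, norm_smul, pNorm]

/-- The epigraph cone of the projective norm. -/
def projCone (p r : ℝ≥0∞) (m n : ℕ) : PointedCone ℝ ((Fin m → Fin n → ℂ) × ℝ) :=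
  PointedCone.hull ℝ {e | ∃ (a : Fin m → ℂ) (b : Fin n → ℂ) (s : ℝ), 0 ≤ s ∧
    e = (fun i j => a i * b j, pNorm p a * pNorm r b + s)}

lemma projNorm_le_of_mem {Z : Fin m → Fin n → ℂ} {t : ℝ} (h : (Z, t) ∈ projCone p r m n) :
    projNorm p r (Matrix.of Z) ≤ t := by
  obtain ⟨d, f, g, hfg⟩ := (Submodule.mem_span_set').1 h
  choose a b s hs hg using fun k => (g k).2
  simp only [hg] at hfg
  have h1 := congrArg Prod.fst hfg
  have h2 := congrArg Prod.snd hfg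
  simp only [Prod.fst_sum, Prod.snd_sum, Prod.smul_fst, Prod.smul_snd] at h1 h2
  have hle : ∑ k, pNorm p (((f k : ℝ) : ℂ) • a k) * pNorm r (b k) ≤ t := by
    rw [← h2]
    refine Finset.sum_le_sum fun k _ => ?_
    rw [pNorm_smul, Complex.norm_real, Real.norm_eq_abs, abs_of_nonneg (f k).2, mul_assoc]
    exact mul_le_mul_of_nonneg_left (le_add_of_nonneg_right (hs k)) (f k).2
  refine le_trans (csInf_le ⟨0, ?_⟩ ⟨d, fun k => ((f k : ℝ) : ℂ) • a k, b, ?_, rfl⟩) hle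
  · rintro _ ⟨d, a, b, -, rfl⟩
    exact Finset.sum_nonneg fun k _ => mul_nonneg (pNorm_nonneg _) (pNorm_nonneg _)
  · ext i j
    have := congrFun (congrFun h1 i) j
    simp only [Finset.sum_apply, Pi.smul_apply] at this
    rw [Matrix.of_apply, ← this, Matrix.sum_apply]
    refine Finset.sum_congr rfl fun k _ => ?_
    exact (mul_assoc (((f k : ℝ) : ℂ)) (a k i) (b k j)).symm

omit [Fact (1 ≤ r)] in
lemma small_mem_projCone (W : Fin m → Fin n → ℂ) :
    (W, ∑ i, ∑ j, ‖W i j‖ * (pNorm p (Pi.single i 1 : Fin m → ℂ) *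
      pNorm r (Pi.single j 1 : Fin n → ℂ))) ∈ projCone p r m n := by
  have e : (W, ∑ i, ∑ j, ‖W i j‖ * (pNorm p (Pi.single i 1 : Fin m → ℂ) *
      pNorm r (Pi.single j 1 : Fin n → ℂ))) =
      ∑ i, ∑ j, ((fun i' j' => (W i j • (Pi.single i 1 : Fin m → ℂ)) i' *
        (Pi.single j 1 : Fin n → ℂ) j', pNorm p (W i j • (Pi.single i 1 : Fin m → ℂ)) *
        pNorm r (Pi.single j 1 : Fin n → ℂ) + 0) : (Fin m → Fin n → ℂ) × ℝ) := by
    refine Prod.ext ?_ ?_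
    · ext i j
      simp [Prod.fst_sum, Finset.sum_apply, Pi.single_apply]
    · simp only [Prod.snd_sum, pNorm_smul, add_zero, mul_assoc]
  rw [e]
  exact Submodule.sum_mem _ fun i _ => Submodule.sum_mem _ fun j _ =>
    Submodule.subset_span ⟨_, _, 0, le_rfl, rfl⟩

/-- A functional nonnegative on the epigraph cone is a pair `(Y, t)` with `t ≥ 0`, and `Y` is
bounded by `t` on elementary tensors; rescaled by `t`, it lies in the dual ball. -/
lemma mem_closure_projCone (X : Matrix (Fin m) (Fin n) ℂ) {C : ℝ}
    (h : ∀ Y, (∀ a b, ‖pair (Matrix.vecMulVec a b) Y‖ ≤ pNorm p a * pNorm r b) →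
      ‖pair X Y‖ ≤ C) :
    ((fun i j => X i j, C) : (Fin m → Fin n → ℂ) × ℝ) ∈ closure (projCone p r m n : Set _) := by
  refine mem_closure_hull fun f hf => ?_
  obtain ⟨Y, hY⟩ := exists_re_pair (f.toLinearMap ∘ₗ LinearMap.inl ℝ _ _)
  set t := f (0, 1) with ht
  have hfe : ∀ Z τ, f (Z, τ) = (pair Z Y).re + τ * t := by
    intro Z τ
    have e : ((Z, τ) : (Fin m → Fin n → ℂ) × ℝ) = (Z, 0) + τ • (0, 1) := by simp
    rw [e, map_add, map_smul, smul_eq_mul, ← hY]; rfl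
  have ht0 : 0 ≤ t := by
    refine hf _ ⟨0, 0, 1, zero_le_one, Prod.ext ?_ ?_⟩
    · ext i j; simp
    · simp [pNorm]
  have hle : ∀ (a : Fin m → ℂ) (b : Fin n → ℂ),
      ‖pair (Matrix.vecMulVec a b) Y‖ ≤ t * (pNorm p a * pNorm r b) := by
    intro a b
    obtain ⟨w, hw, hwz⟩ := exists_phase (pair (Matrix.vecMulVec a b) Y)
    have h1 := hf _ ⟨(-w) • a, b, 0, le_rfl, rfl⟩
    have e : pair (fun i j => ((-w) • a) i * b j) Y =
        -(w * pair (Matrix.vecMulVec a b) Y) := by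
      simp only [pair, Matrix.vecMulVec_apply, Finset.mul_sum, Pi.smul_apply, smul_eq_mul,
        ← Finset.sum_neg_distrib]
      exact Finset.sum_congr rfl fun i _ => Finset.sum_congr rfl fun j _ => by ring
    rw [hfe, e, hwz, pNorm_smul, norm_neg, hw, one_mul, add_zero, Complex.neg_re,
      Complex.ofReal_re] at h1
    linarith
  rw [hfe]
  have hre := (abs_le.1 (Complex.abs_re_le_norm (pair X Y))).1
  suffices hs : ‖pair X Y‖ ≤ C * t by
    change 0 ≤ (pair X Y).re + C * t
    linarith
  -- For `t = 0` no rescaling is possible, but then `Y` vanishes on all matrix units.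
  rcases ht0.eq_or_lt with h0 | h0
  · have hY0 : Y = 0 := by
      ext i j
      have := hle (Pi.single i 1) (Pi.single j 1)
      rw [← single_eq_vecMulVec, pair_comm, pair_single, ← h0, zero_mul] at this
      simpa using this
    rw [← h0, hY0]; simp [pair]
  · have htc : ‖((t : ℂ))⁻¹‖ = t⁻¹ := by
      rw [norm_inv, Complex.norm_real, Real.norm_eq_abs, abs_of_pos h0]
    have := h ((t : ℂ)⁻¹ • Y) fun a b => by
      rw [pair_smul_right, norm_mul, htc, inv_mul_le_iff₀ h0]
      exact hle a b
    rw [pair_smul_right, norm_mul, htc, inv_mul_le_iff₀ h0] at this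
    linarith

/-- One direction of the duality between the projective norm and bounded bilinear forms. The
approximation error is expanded in matrix units, whose total cost `M` determines the accuracy `ε /
(1 + M)`. -/
theorem projNorm_le (X : Matrix (Fin m) (Fin n) ℂ) {C : ℝ}
    (h : ∀ Y, (∀ a b, ‖pair (Matrix.vecMulVec a b) Y‖ ≤ pNorm p a * pNorm r b) →
      ‖pair X Y‖ ≤ C) : projNorm p r X ≤ C := by
  set M := ∑ i, ∑ j, pNorm p (Pi.single i 1 : Fin m → ℂ) * pNorm r (Pi.single j 1 : Fin n → ℂ)
    with hM
  have hM0 : 0 ≤ M := Finset.sum_nonneg fun i _ => Finset.sum_nonneg fun j _ =>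
    mul_nonneg (pNorm_nonneg _) (pNorm_nonneg _)
  refine le_of_forall_pos_le_add fun ε hε => ?_
  have hδ : 0 < ε / (1 + M) := by positivity
  set δ := ε / (1 + M) with hδe
  obtain ⟨⟨Z, t⟩, hmem, hdist⟩ := Metric.mem_closure_iff.1 (mem_closure_projCone X h) δ hδ
  rw [Prod.dist_eq, max_lt_iff] at hdist
  obtain ⟨h1, h2⟩ := hdist
  rw [dist_pi_lt_iff hδ] at h1
  have h3 := projNorm_le_of_mem
    (Submodule.add_mem _ hmem (small_mem_projCone (p := p) (r := r) ((fun i j => X i j) - Z)))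
  have e : Matrix.of ((Z, t).1 + ((fun i j => X i j) - Z)) = X := by
    ext i j; simp
  change projNorm p r (Matrix.of ((Z, t).1 + ((fun i j => X i j) - Z))) ≤ t + _ at h3
  rw [e] at h3
  have h4 : ∑ i, ∑ j, ‖((fun i j => X i j) - Z) i j‖ *
      (pNorm p (Pi.single i 1 : Fin m → ℂ) * pNorm r (Pi.single j 1 : Fin n → ℂ)) ≤ δ * M := by
    rw [hM, Finset.mul_sum]
    refine Finset.sum_le_sum fun i _ => ?_
    rw [Finset.mul_sum]
    refine Finset.sum_le_sum fun j _ => mul_le_mul_of_nonneg_right ?_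
      (mul_nonneg (pNorm_nonneg _) (pNorm_nonneg _))
    have := (dist_pi_lt_iff hδ).1 (h1 i) j
    rw [dist_eq_norm] at this
    exact this.le
  have h5 : t < C + δ := by
    have := (abs_lt.1 (by simpa [Real.dist_eq] using h2 : |C - t| < δ)).1
    linarith
  have h6 : δ + δ * M = ε := by rw [hδe]; field_simp
  linarith

end Proj

lemma bigConst_nonneg : 0 ≤ bigConst := Real.sInf_nonneg fun _ hK => hK.1

/-- A matrix `Y` in the dual ball of the projective norm has `normB Y ≤ 1`, hence `normCbB Y ≤
bigConst`; `normS` and `normCbB` are in duality. -/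
theorem projNorm_top_top_le (X : Matrix (Fin m) (Fin n) ℂ) :
    projNorm ∞ ∞ X ≤ bigConst * normS X := by
  refine projNorm_le X fun Y hY => ?_
  have hB : normB Y ≤ 1 := (isPairSup_normB Y).le_of (by
    rintro _ ⟨f, hf, g, hg, rfl⟩
    rw [pair_comm]
    exact (hY f g).trans (mul_le_one₀ (pNorm_top_le_one_iff.2 (inDualBall_one_iff.1 hf))
      (pNorm_nonneg _) (pNorm_top_le_one_iff.2 (inDualBall_one_iff.1 hg))))
  have hcb : normCbB Y ≤ bigConst :=
    (normCbB_le_bigConst Y).trans (mul_le_of_le_one_right bigConst_nonneg hB)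
  rw [mul_comm]
  exact (dualSystem_normS.norm_pair_le X Y).trans
    (mul_le_mul_of_nonneg_left hcb (isPairSup_normS X).nonneg)

theorem projNorm_two_top_le (X : Matrix (Fin m) (Fin n) ℂ) :
    projNorm 2 ∞ X ≤ √littleConst * normT X := by
  refine projNorm_le X fun Y hY => ?_
  have hF : normF Y ≤ 1 := (isPairSup_normF Y).le_of (by
    rintro _ ⟨f, hf, g, hg, rfl⟩
    rw [pair_comm]
    exact (hY f g).trans (mul_le_one₀ (pNorm_two_le_one_iff.2 (inDualBall_two_iff.1 hf))
      (pNorm_nonneg _) (pNorm_top_le_one_iff.2 (inDualBall_one_iff.1 hg))))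
  have hcb : normCbF Y ≤ √littleConst :=
    (normCbF_le_littleConst Y).trans (mul_le_of_le_one_right (Real.sqrt_nonneg _) hF)
  rw [mul_comm]
  exact (dualSystem_normT.norm_pair_le X Y).trans
    (mul_le_mul_of_nonneg_left hcb (isPairSup_normT X).nonneg)

/-! ### The Haagerup norm and the norms defined by Hilbert space factorizations -/

lemma iSup_norm_nonneg {ι E : Type*} [SeminormedAddCommGroup E] (x : ι → E) : 0 ≤ ⨆ i, ‖x i‖ :=
  Real.iSup_nonneg fun _ => norm_nonneg _

lemma norm_inv_smul_iSup_le {ι E : Type*} [Finite ι] [NormedAddCommGroup E] [NormedSpace ℂ E]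
    (x : ι → E) (i : ι) : ‖(((⨆ i, ‖x i‖ : ℝ) : ℂ))⁻¹ • x i‖ ≤ 1 := by
  rw [norm_smul, norm_inv, Complex.norm_real, Real.norm_eq_abs, abs_of_nonneg (iSup_norm_nonneg x),
    inv_mul_eq_div]
  exact div_le_one_of_le₀ (le_ciSup (f := fun i => ‖x i‖) (Set.finite_range _).bddAbove i)
    (iSup_norm_nonneg x)

lemma iSup_smul_inv_smul {ι E : Type*} [Finite ι] [NormedAddCommGroup E] [NormedSpace ℂ E]
    (x : ι → E) (i : ι) : ((⨆ i, ‖x i‖ : ℝ) : ℂ) • (((⨆ i, ‖x i‖ : ℝ) : ℂ))⁻¹ • x i = x i := by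
  by_cases h : (⨆ i, ‖x i‖) = 0
  · have h1 := le_ciSup (f := fun i => ‖x i‖) (Set.finite_range _).bddAbove i
    rw [h] at h1
    have h2 : x i = 0 := norm_le_zero_iff.1 h1
    rw [h2]; simp
  · exact smul_inv_smul₀ (by exact_mod_cast h) _

theorem normS_eq_normH (X : Matrix (Fin m) (Fin n) ℂ) : normS X = normH X := by
  have key : ∀ c, normS X < c → ∃ t ∈ {t | ∃ (d : ℕ) (x : Fin m → EuclideanSpace ℂ (Fin d))
      (y : Fin n → EuclideanSpace ℂ (Fin d)),
      (∀ i j, X i j = inner ℂ (x i) (y j)) ∧ t = (⨆ i, ‖x i‖) * ⨆ j, ‖y j‖}, t ≤ c := by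
    intro c hc
    have hc0 := (isPairSup_normS X).nonneg.trans hc.le
    obtain ⟨Z, hZ, hX⟩ := dualSystem_normS.exists_smul X c hc
    obtain ⟨d, x, y, hxy, hx, hy⟩ := exists_inner_of_mem_gramId hZ
    refine ⟨_, ⟨d, x, fun j => (c : ℂ) • y j, fun i j => ?_, rfl⟩, ?_⟩
    · rw [hX, inner_smul_right, ← hxy]; rfl
    · rw [← one_mul c]
      refine mul_le_mul (Real.iSup_le hx zero_le_one) (Real.iSup_le (fun j => ?_) ?_)
        (iSup_norm_nonneg _) zero_le_one
      · rw [norm_smul, one_mul, Complex.norm_real, Real.norm_eq_abs, abs_of_nonneg hc0]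
        exact mul_le_of_le_one_right hc0 (hy j)
      · simpa using hc0
  refine le_antisymm (le_csInf ?_ ?_) (le_of_forall_gt_imp_ge_of_dense fun c hc => ?_)
  · obtain ⟨t, ht, -⟩ := key (normS X + 1) (lt_add_one _)
    exact ⟨t, ht⟩
  · rintro _ ⟨d, x, y, hxy, rfl⟩
    -- Dividing both families by their suprema puts them into unit balls. If a supremum is `0`, the
    -- whole family is zero and inverting by convention does no harm.
    have hZ := pair_inner_mem_gramId (norm_inv_smul_iSup_le x) (norm_inv_smul_iSup_le y)
    have hX : X = (((⨆ i, ‖x i‖ : ℝ) : ℂ) * ((⨆ j, ‖y j‖ : ℝ) : ℂ)) • (Matrix.of fun i j =>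
        inner ℂ ((((⨆ i, ‖x i‖ : ℝ) : ℂ))⁻¹ • x i) ((((⨆ j, ‖y j‖ : ℝ) : ℂ))⁻¹ • y j)) := by
      ext i j
      rw [hxy, Matrix.smul_apply, Matrix.of_apply, smul_eq_mul]
      conv_lhs => rw [← iSup_smul_inv_smul x i, ← iSup_smul_inv_smul y j]
      rw [inner_smul_left, inner_smul_right, Complex.conj_ofReal]
      ring
    rw [hX, isCrossNorm_normS.1.2.2, norm_mul, Complex.norm_real, Complex.norm_real,
      Real.norm_eq_abs, Real.norm_eq_abs, abs_of_nonneg (iSup_norm_nonneg x),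
      abs_of_nonneg (iSup_norm_nonneg y)]
    exact mul_le_of_le_one_right (mul_nonneg (iSup_norm_nonneg x) (iSup_norm_nonneg y))
      (dualSystem_normS.le_one _ hZ)
  · obtain ⟨t, ht, htc⟩ := key c hc
    refine (csInf_le ⟨0, ?_⟩ ht).trans htc
    rintro _ ⟨d, x, y, -, rfl⟩
    exact mul_nonneg (iSup_norm_nonneg _) (iSup_norm_nonneg _)

lemma pNorm_top_sum_star_mul {d k : ℕ} (a : Fin d → Fin k → ℂ) :
    pNorm ∞ (∑ l, star (a l) * a l) =
      (⨆ i, ‖(WithLp.toLp 2 fun l => a l i : EuclideanSpace ℂ (Fin d))‖) ^ 2 := by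
  have h : ∀ i, ‖(∑ l, star (a l) * a l) i‖ =
      ‖(WithLp.toLp 2 fun l => a l i : EuclideanSpace ℂ (Fin d))‖ ^ 2 := by
    intro i
    have e : (∑ l, star (a l) * a l) i = ((∑ l, ‖a l i‖ ^ 2 : ℝ) : ℂ) := by
      simp [Finset.sum_apply, Complex.conj_mul']
    rw [e, Complex.norm_real, Real.norm_eq_abs, abs_of_nonneg (by positivity),
      EuclideanSpace.norm_sq_eq]
  rw [pNorm_top]
  simp only [h]
  rw [Real.iSup_pow_of_ne_zero (fun i => norm_nonneg _) two_ne_zero]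

/-- The infima run over the same set of numbers: `a_k(i)` and `b_k(j)` are the `k`-th coordinates of
`x_i` and `y_j`. -/
theorem haagerupNorm_eq_normH (X : Matrix (Fin m) (Fin n) ℂ) : haagerupNorm X = normH X := by
  unfold haagerupNorm normH
  congr 1
  ext t
  constructor
  · rintro ⟨d, a, b, rfl, rfl⟩
    refine ⟨d, fun i => WithLp.toLp 2 fun l => a l i, fun j => WithLp.toLp 2 fun l => b l j,
      fun i j => ?_, ?_⟩
    · simp [Matrix.sum_apply, Matrix.vecMulVec_apply, PiLp.inner_apply, mul_comm]
    · rw [pNorm_top_sum_star_mul, pNorm_top_sum_star_mul, ← mul_pow,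
        Real.sqrt_sq (mul_nonneg (iSup_norm_nonneg _) (iSup_norm_nonneg _))]
  · rintro ⟨d, x, y, hxy, rfl⟩
    refine ⟨d, fun l i => x i l, fun l j => y j l, ?_, ?_⟩
    · ext i j
      simp [hxy, Matrix.sum_apply, Matrix.vecMulVec_apply, PiLp.inner_apply, mul_comm]
    · rw [pNorm_top_sum_star_mul, pNorm_top_sum_star_mul, ← mul_pow,
        Real.sqrt_sq (mul_nonneg (iSup_norm_nonneg _) (iSup_norm_nonneg _))]

theorem normCbB_eq_normH' (X : Matrix (Fin m) (Fin n) ℂ) : normCbB X = normH' X := by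
  have h := dualSystem_normS.isPairSup_ball X
  have e : normH' X = sSup {t | ∃ Y ∈ {Y | normS Y ≤ 1}, t = ‖pair X Y‖} := by
    unfold normH'
    congr 1
    ext t
    simp only [normS_eq_normH, Set.mem_ofPred_eq, pair]
  rw [e, IsLUB.csSup_eq h h.nonempty]

/-! ### Factorization through Hilbert space and its trace dual -/

lemma mapNorm_two_top {d k : ℕ} (C : Matrix (Fin k) (Fin d) ℂ) :
    mapNorm 2 ∞ C = ⨆ j, ‖(WithLp.toLp 2 fun l => C j l : EuclideanSpace ℂ (Fin d))‖ := by
  have hle : ∀ t ∈ {t | ∃ z : Fin d → ℂ, pNorm 2 z ≤ 1 ∧ t = pNorm ∞ (C *ᵥ z)},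
      t ≤ ⨆ j, ‖(WithLp.toLp 2 fun l => C j l : EuclideanSpace ℂ (Fin d))‖ := by
    rintro _ ⟨z, hz, rfl⟩
    refine pNorm_top_le (iSup_norm_nonneg _) fun j => ?_
    refine le_trans ?_ (le_ciSup (f := fun j =>
      ‖(WithLp.toLp 2 fun l => C j l : EuclideanSpace ℂ (Fin d))‖) (Set.finite_range _).bddAbove j)
    refine (norm_sum_mul_le _ _).trans ?_
    rw [EuclideanSpace.norm_eq]
    exact mul_le_of_le_one_right (Real.sqrt_nonneg _) (by rwa [pNorm_two] at hz)
  have h0 : (0 : ℝ) ∈ {t | ∃ z : Fin d → ℂ, pNorm 2 z ≤ 1 ∧ t = pNorm ∞ (C *ᵥ z)} :=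
    ⟨0, by simp [pNorm], by simp [pNorm]⟩
  refine le_antisymm (csSup_le ⟨0, h0⟩ hle)
    (Real.iSup_le (fun j => ?_) (le_csSup ⟨_, hle⟩ h0))
  rw [EuclideanSpace.norm_eq]
  refine sum_sq_le_one_of_pairing (le_csSup ⟨_, hle⟩ h0) fun u hu => ?_
  refine le_trans ?_ (le_csSup ⟨_, hle⟩ ⟨u, pNorm_two_le_one_iff.2 hu, rfl⟩)
  refine le_trans (le_of_eq ?_) (le_pNorm_top _ j)
  simp [Matrix.mulVec, dotProduct, mul_comm]

/-- The norm is the largest column norm, by convexity of the `1`-ball. The conjugates are harmless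
for norms and match the convention that the inner product is conjugate-linear in its first variable.
-/
lemma mapNorm_one_two {d k : ℕ} (A : Matrix (Fin d) (Fin k) ℂ) :
    mapNorm 1 2 A = ⨆ i, ‖(WithLp.toLp 2 fun l => star (A l i) : EuclideanSpace ℂ (Fin d))‖ := by
  set M := ⨆ i, ‖(WithLp.toLp 2 fun l => star (A l i) : EuclideanSpace ℂ (Fin d))‖ with hM
  have hM0 : 0 ≤ M := iSup_norm_nonneg _
  have hcol : ∀ i, √(∑ l, ‖A l i‖ ^ 2) ≤ M := by
    intro i
    have := le_ciSup (f := fun i =>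
      ‖(WithLp.toLp 2 fun l => star (A l i) : EuclideanSpace ℂ (Fin d))‖)
      (Set.finite_range _).bddAbove i
    simpa [hM, EuclideanSpace.norm_eq] using this
  have hle : ∀ t ∈ {t | ∃ z : Fin k → ℂ, pNorm 1 z ≤ 1 ∧ t = pNorm 2 (A *ᵥ z)}, t ≤ M := by
    rintro _ ⟨z, hz, rfl⟩
    rw [pNorm_two]
    refine sum_sq_le_one_of_pairing hM0 fun u hu => ?_
    rw [sum_mulVec, Finset.sum_comm]
    simp only [← Finset.sum_mul]
    refine (norm_sum_le _ _).trans ?_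
    calc _ ≤ ∑ i, M * ‖z i‖ := Finset.sum_le_sum fun i _ => by
          rw [norm_mul]
          refine mul_le_mul_of_nonneg_right ((norm_sum_mul_le _ _).trans ?_) (norm_nonneg _)
          exact (mul_le_of_le_one_left (Real.sqrt_nonneg _) (Real.sqrt_le_one.2 hu)).trans (hcol i)
      _ ≤ M := by
          rw [← Finset.mul_sum, ← pNorm_one]
          exact mul_le_of_le_one_right hM0 hz
  have h0 : (0 : ℝ) ∈ {t | ∃ z : Fin k → ℂ, pNorm 1 z ≤ 1 ∧ t = pNorm 2 (A *ᵥ z)} :=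
    ⟨0, by simp [pNorm], by simp [pNorm]⟩
  refine le_antisymm (csSup_le ⟨0, h0⟩ hle)
    (Real.iSup_le (fun i => ?_) (le_csSup ⟨_, hle⟩ h0))
  refine le_trans (le_of_eq ?_) (le_csSup ⟨_, hle⟩ ⟨Pi.single i 1, ?_, rfl⟩)
  · simp [pNorm_two, EuclideanSpace.norm_eq]
  · rw [pNorm_one, Finset.sum_eq_single i (by simp +contextual) (by simp)]; simp

/-- In `V = C * A` the rows of `C` are the `y_j` and the columns of `A` are the conjugates of the
`x_i`. The transpose appears because `V` maps in the direction opposite to `X`. -/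
theorem gammaTwo_eq_normH (V : Matrix (Fin n) (Fin m) ℂ) : gammaTwo 1 ∞ V = normH Vᵀ := by
  unfold gammaTwo normH
  congr 1
  ext t
  constructor
  · rintro ⟨d, C, A, rfl, rfl⟩
    refine ⟨d, fun i => WithLp.toLp 2 fun l => star (A l i), fun j => WithLp.toLp 2 fun l => C j l,
      fun i j => ?_, ?_⟩
    · simp [Matrix.mul_apply, PiLp.inner_apply]
    · rw [mapNorm_two_top, mapNorm_one_two, mul_comm]
  · rintro ⟨d, x, y, hxy, rfl⟩
    refine ⟨d, Matrix.of fun j l => y j l, Matrix.of fun l i => star (x i l), ?_, ?_⟩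
    · ext j i
      have := hxy i j
      rw [Matrix.transpose_apply] at this
      rw [this]
      simp [Matrix.mul_apply, PiLp.inner_apply]
    · rw [mapNorm_two_top, mapNorm_one_two, mul_comm]
      simp

theorem gammaTwoStar_eq_normH' (X : Matrix (Fin m) (Fin n) ℂ) :
    gammaTwoStar ∞ 1 X = normH' X := by
  have e : ∀ V : Matrix (Fin n) (Fin m) ℂ, (X * V).trace = ∑ i, ∑ j, X i j * Vᵀ i j := by
    intro V; simp [Matrix.trace, Matrix.mul_apply]
  unfold gammaTwoStar normH'
  congr 1
  ext t
  constructor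
  · rintro ⟨V, hV, rfl⟩
    exact ⟨Vᵀ, gammaTwo_eq_normH V ▸ hV, by rw [e]⟩
  · rintro ⟨Y, hY, rfl⟩
    exact ⟨Yᵀ, by rwa [gammaTwo_eq_normH, Matrix.transpose_transpose], by
      rw [e, Matrix.transpose_transpose]⟩

end GrothendieckNorms

end

/-! ### Assembly of the theorem -/

theorem mainTheorem8 (m n : ℕ) :
    (∀ (X : Matrix (Fin m) (Fin n) ℂ) (μ : Fin m → ℂ) (ν : Fin n → ℂ),
      X ≠ 0 → X.rank = 1 → (∀ i j, X i j = μ i * ν j) →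
        (GrothendieckNorms.normF X = GrothendieckNorms.pNorm 2 μ * GrothendieckNorms.pNorm 1 ν ∧
          GrothendieckNorms.normCbF X =
            GrothendieckNorms.pNorm 2 μ * GrothendieckNorms.pNorm 1 ν) ∧
        (GrothendieckNorms.normB X = GrothendieckNorms.pNorm 1 μ * GrothendieckNorms.pNorm 1 ν ∧
          GrothendieckNorms.normCbB X =
            GrothendieckNorms.pNorm 1 μ * GrothendieckNorms.pNorm 1 ν) ∧
        GrothendieckNorms.normS X = GrothendieckNorms.pNorm ∞ μ * GrothendieckNorms.pNorm ∞ ν ∧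
        GrothendieckNorms.normT X = GrothendieckNorms.pNorm 2 μ * GrothendieckNorms.pNorm ∞ ν) ∧
    ((GrothendieckNorms.IsCrossNorm 2 1 (GrothendieckNorms.normF (m := m) (n := n)) ∧
        ∀ X : Matrix (Fin m) (Fin n) ℂ,
          GrothendieckNorms.normF X = GrothendieckNorms.injNorm 2 1 X) ∧
      GrothendieckNorms.IsCrossNorm 2 1 (GrothendieckNorms.normCbF (m := m) (n := n)) ∧
      (∀ X : Matrix (Fin m) (Fin n) ℂ, GrothendieckNorms.normCbF X ≤
        √GrothendieckNorms.littleConst * GrothendieckNorms.normF X) ∧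
      GrothendieckNorms.IsConjDual (GrothendieckNorms.normCbF (m := m) (n := n))
        GrothendieckNorms.normT) ∧
    ((GrothendieckNorms.IsCrossNorm 1 1 (GrothendieckNorms.normB (m := m) (n := n)) ∧
        ∀ X : Matrix (Fin m) (Fin n) ℂ,
          GrothendieckNorms.normB X = GrothendieckNorms.injNorm 1 1 X) ∧
      GrothendieckNorms.IsCrossNorm 1 1 (GrothendieckNorms.normCbB (m := m) (n := n)) ∧
      (∀ X : Matrix (Fin m) (Fin n) ℂ, GrothendieckNorms.normCbB X ≤
        GrothendieckNorms.bigConst * GrothendieckNorms.normB X) ∧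
      GrothendieckNorms.IsConjDual (GrothendieckNorms.normCbB (m := m) (n := n))
        GrothendieckNorms.normS) ∧
    ((∀ X : Matrix (Fin m) (Fin n) ℂ,
        GrothendieckNorms.normS X = GrothendieckNorms.normCbS X) ∧
      GrothendieckNorms.IsCrossNorm ∞ ∞ (GrothendieckNorms.normS (m := m) (n := n)) ∧
      (∀ X : Matrix (Fin m) (Fin n) ℂ, GrothendieckNorms.projNorm ∞ ∞ X ≤
        GrothendieckNorms.bigConst * GrothendieckNorms.normS X) ∧
      GrothendieckNorms.IsConjDual (GrothendieckNorms.normS (m := m) (n := n))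
        GrothendieckNorms.normCbB) ∧
    ((∀ X : Matrix (Fin m) (Fin n) ℂ,
        GrothendieckNorms.normT X = GrothendieckNorms.normCbT X) ∧
      GrothendieckNorms.IsCrossNorm 2 ∞ (GrothendieckNorms.normT (m := m) (n := n)) ∧
      (∀ X : Matrix (Fin m) (Fin n) ℂ, GrothendieckNorms.projNorm 2 ∞ X ≤
        √GrothendieckNorms.littleConst * GrothendieckNorms.normT X) ∧
      GrothendieckNorms.IsConjDual (GrothendieckNorms.normT (m := m) (n := n))
        GrothendieckNorms.normCbF) ∧
    (∀ X : Matrix (Fin m) (Fin n) ℂ,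
      GrothendieckNorms.normS X = GrothendieckNorms.normH X ∧
      GrothendieckNorms.normS X = GrothendieckNorms.haagerupNorm X) ∧
    (∀ X : Matrix (Fin m) (Fin n) ℂ,
      GrothendieckNorms.normCbB X = GrothendieckNorms.gammaTwoStar ∞ 1 X ∧
      GrothendieckNorms.normCbB X = GrothendieckNorms.normH' X) := by
  refine ⟨fun X μ ν _ _ hX => ?_, ⟨⟨GrothendieckNorms.isCrossNorm_normF, GrothendieckNorms.normF_eq_injNorm⟩, GrothendieckNorms.isCrossNorm_normCbF,
    GrothendieckNorms.normCbF_le_littleConst, GrothendieckNorms.dualSystem_normT.isConjDual_right⟩,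
    ⟨⟨GrothendieckNorms.isCrossNorm_normB, GrothendieckNorms.normB_eq_injNorm⟩, GrothendieckNorms.isCrossNorm_normCbB, GrothendieckNorms.normCbB_le_bigConst,
      GrothendieckNorms.dualSystem_normS.isConjDual_right⟩,
    ⟨GrothendieckNorms.normS_eq_normCbS, GrothendieckNorms.isCrossNorm_normS, GrothendieckNorms.projNorm_top_top_le, GrothendieckNorms.dualSystem_normS.isConjDual_left⟩,
    ⟨GrothendieckNorms.normT_eq_normCbT, GrothendieckNorms.isCrossNorm_normT, GrothendieckNorms.projNorm_two_top_le, GrothendieckNorms.dualSystem_normT.isConjDual_left⟩,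
    fun X => ⟨GrothendieckNorms.normS_eq_normH X, (GrothendieckNorms.normS_eq_normH X).trans (GrothendieckNorms.haagerupNorm_eq_normH X).symm⟩,
    fun X => ⟨(GrothendieckNorms.normCbB_eq_normH' X).trans (GrothendieckNorms.gammaTwoStar_eq_normH' X).symm, GrothendieckNorms.normCbB_eq_normH' X⟩⟩
  obtain rfl : X = Matrix.vecMulVec μ ν := by ext i j; exact hX i j
  exact ⟨⟨GrothendieckNorms.isCrossNorm_normF.2 μ ν, GrothendieckNorms.isCrossNorm_normCbF.2 μ ν⟩,
    ⟨GrothendieckNorms.isCrossNorm_normB.2 μ ν, GrothendieckNorms.isCrossNorm_normCbB.2 μ ν⟩, GrothendieckNorms.isCrossNorm_normS.2 μ ν,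
    GrothendieckNorms.isCrossNorm_normT.2 μ ν⟩
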